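/- **Conventions.** Algorithms are uniform, $\lambda$ is the security parameter, and "PPT" for a sampling algorithm of a scheme or generator means polynomial time with polynomially long outputs, up to a negligible statistical error (exact uniform sampling is not possible with fair coins). A PPT adversary makes polynomially many rounds of polynomial-time computation and oracle queries, with states, queries and outputs of length polynomial in its input. The advantage in an experiment with outcome in $\{0,1\}$ is $|\Pr[\text{outcome}=1]-\tfrac12|$. An adversary is admissible if it always respects the stated restrictions on its output. **Predicate encryption (PE).** A PE scheme $\mathcal E=(G,K,E,D)$ has a message space $M$, an attribute set $A$, a class $\mathcal F$ of predicates on $A$ (given by descriptions) and a finite ciphertext space $\hat{\mathcal C}$ (all of which may depend on $\lambda$ and $\mathsf{PP}$), PPT algorithms $(\mathsf{PP},\mathsf{MSK})\gets G(1^\lambda)$, $\mathsf{sk}_f\gets K(\mathsf{MSK},f)$, $c\gets E(\mathsf{PP},a,m)$, and a deterministic polynomial-time $D$ such that $D_{\mathsf{sk}_f}(c)=m$ if $f(a)=1$ and $D_{\mathsf{sk}_f}(c)=\bot$ if $f(a)=0$, for every $c\gets E(\mathsf{PP},a,m)$. Inputs outside $\hat{\mathcal C}$ are decrypted to $\bot$.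 Put $\mathsf{supp}(f)=\{a\in A: f(a)=1\}$. **Group-homomorphic PE.** $\mathcal E$ is group homomorphic if for all $(\mathsf{PP},\mathsf{MSK})$ output by $G$, $M$ is a non-trivial group and there is a binary operation $*$ on $\hat{\mathcal C}$ such that for every $f\in\mathcal F$ with $\mathsf{supp}(f)\ne\emptyset$ and every $\mathsf{sk}_f$: the function $D_{\mathsf{sk}_f}$ on $\hat{\mathcal C}$ depends only on $f$; $\hat{\mathcal C}_f=\{c\in\hat{\mathcal C}:D_{\mathsf{sk}_f}(c)\neq\bot\}$ is a non-trivial group under $*$; the set $\mathcal C_f$ of encryptions in $\hat{\mathcal C}_f$ under attributes in $\mathsf{supp}(f)$ is a subgroup; $D_{\mathsf{sk}_f}:\hat{\mathcal C}_f\to M$ is a surjective homomorphism; no PPT adversary which receives $\mathsf{PP}$, has a key generation oracle throughout, chooses $f$ with $\mathsf{supp}(f)\neq\emptyset$ and then receives $\mathsf{sk}_f$ and an element $c$, distinguishes $c$ uniform in $\mathcal C_f$ from $c$ uniform in $\hat{\mathcal C}_f$ with non-negligible advantage; and there is a polynomial-time $\tau:A\to\mathcal F$ such that $a'\in\mathsf{supp}(\tau(a))$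 implies $g(a')=g(a)$ for all $g\in\mathcal F$. **GIFT.** A group-homomorphic $\mathcal E$ is generic shift-type (GIFT) if $\mathsf{PP}$ determines, for every $f\in\mathcal F$, a non-trivial proper normal subgroup $\mathcal N_f$ of $\mathcal C_f$ and a map $\psi_f:M\to\mathcal C_f$ that is a bijection onto a system $\mathcal R_f$ of representatives of $\mathcal C_f/\mathcal N_f$ and a homomorphism modulo $\mathcal N_f$, such that: - $E(\mathsf{PP},a,m)=\psi_f(m)*n$ with $f=\tau(a)$ and $n$ uniform in $\mathcal N_f$; - with $\hat{\mathcal N}_f=\{c\in\hat{\mathcal C}_f: D_{\mathsf{sk}_f}(c)=1_M\}$ one has $\mathcal N_f\subseteq\hat{\mathcal N}_f$, and for $c\in\hat{\mathcal C}_f$, $D_{\mathsf{sk}_f}(c)=m$ iff $m\in M$ and $c=\psi_f(m)*n$ for some $n\in\hat{\mathcal N}_f$; - given $\mathsf{PP}$, the following are computable in polynomial time: $(f,m)\mapsto\psi_f(m)$, $(f,\psi_f(m))\mapsto m$, the multiplication and inversion in $\hat{\mathcal C}_f$, and some map $f\mapsto a\in\mathsf{supp}(f)$ (so all supports are non-empty);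 and uniform elements of $M$ can be sampled in polynomial time up to a negligible statistical error. **IND-AD-CCA1.** The adversary gets $\mathsf{PP}$. In phase 1 it may ask for $K(\mathsf{MSK},f)$, $f\in\mathcal F$, and for $D_{\mathsf{sk}_f}(c)$, for arbitrary $(f,c)$. It outputs $a^*\in A$ and $m_0,m_1\in M$, such that $f(a^*)=0$ for all $f$ whose keys it has asked for. It gets $E(\mathsf{PP},a^*,m_b)$ for a uniform bit $b$; in phase 2 it may ask for keys for $f$ with $f(a^*)=0$ (and gets $\bot$ for other $f$), and it outputs a guess for $b$. The scheme is secure if every admissible PPT adversary has negligible advantage. **ISOAP.** A generator $G'$ outputs a description of a finite set $\hat{\mathcal G}$ with a binary operation $*$, an index set $\mathcal I$, a family $\{(\mathcal G_i,\mathcal R_i,\mathcal N_i)\}_{i\in\mathcal I}$, and a trapdoor $k$. Here $\mathcal G_i\subseteq\hat{\mathcal G}$ is a non-trivial group under $*$, $\mathcal N_i$ is a non-trivial proper subgroup, $\mathcal R_i\subseteq\mathcal G_i$ is a set of representatives (each $c\in\mathcal G_i$ is uniquely $r*n$ with $r\in\mathcal R_i$, $n\in\mathcal N_i$), and $|\mathcal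 R_i|=|\mathcal R_j|$ for all $i,j$. A PPT algorithm $K_k(i)$ outputs a description of a polynomial-time function $\sigma_i:r*n\mapsto(r,n)$ on $\mathcal G_i$. The adversary gets the public description. In phase 1 it may ask for $K_k(i)$ and for $\sigma_i(c)$ ($\bot$ if $c\notin\mathcal G_i$). It outputs $\mathsf{ind}\in\mathcal I$ such that $\mathcal G_{\mathsf{ind}}\cap\mathcal G_j=\emptyset$ for all $j$ whose keys it has asked for. It gets $c^*$, uniform in $\mathcal G_{\mathsf{ind}}$ if $b=1$ and uniform in $\mathcal N_{\mathsf{ind}}$ if $b=0$, for a uniform bit $b$. In phase 2 it may ask for $K_k(i)$ (and gets $\bot$ if $c^*\in\mathcal G_i$), and it outputs a guess for $b$. ISOAP is hard relative to $G'$ if every admissible PPT adversary has negligible advantage. **Theorem.** Let $\mathcal E=(G,K,E,D)$ be a GIFT PE scheme, and let $G'$ be the algorithm that runs $(\mathsf{PP},\mathsf{MSK})\gets G(1^\lambda)$ and outputs the tuple $(\hat{\mathcal C},\mathcal F,\{(\hat{\mathcal C}_f,\mathcal R_f,\hat{\mathcal N}_f)\}_{f\in\mathcal F},\mathsf{MSK})$,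 with public description $\mathsf{PP}$ and with $K(\mathsf{MSK},f)$ as the algorithm that outputs descriptions of splitting functions. Then $G'$ is a generator as required in the definition of ISOAP (in particular $\hat{\mathcal C}_f=\mathcal R_f*\hat{\mathcal N}_f$ for all $f\in\mathcal F$), and $\mathcal E$ is IND-AD-CCA1 secure if and only if ISOAP is hard relative to $G'$. -/

import Mathlib

namespace PredEnc

/-! ### Data and deterministic polynomial time -/

/-- Binary trees: the objects on which algorithms compute. Numbers, bit strings, keys, ciphertexts,
attributes and (descriptions of) predicates are all coded as such trees. -/
inductive Data : Type
  | nil : Data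
  | node : Data → Data → Data

namespace Data

/-- Number of nodes and leaves: the length of the description. -/
def size : Data → ℕ
  | nil => 1
  | node a b => a.size + b.size + 1

def fst : Data → Data
  | nil => nil
  | node a _ => a

def snd : Data → Data
  | nil => nil
  | node _ b => b

/-- Tuples are coded as nested pairs ending in `nil`. -/
def list : List Data → Data
  | [] => nil
  | a :: l => node a (list l)

/-- The security parameter in unary. -/
def unary : ℕ → Data
  | 0 => nil
  | n + 1 => node nil (unary n)

/-- A string of bits. -/
def bits (r : List Bool) : Data :=
  list (r.map fun b => if b then node nil nil else nil)

/-- `⊥` is coded by `nil`, a proper answer `d` by `node nil d`. -/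
def ofOption : Option Data → Data
  | none => nil
  | some d => node nil d

/-- Reading an output as a bit. -/
def toBool : Data → Bool
  | nil => false
  | node _ _ => true

end Data

/-- A structured programming language on trees: identity, the constant `nil`, the two projections,
pairing, composition, conditional (`ite c f g` runs `f` if the output of `c` is not `nil`, and `g`
otherwise), and the loop that repeats `f` while the first component of the data is not `nil`. -/
inductive Code : Type
  | id : Code
  | nil : Code
  | fst : Code
  | snd : Code
  | pair : Code → Code → Code
  | comp : Code → Code → Code
  | ite : Code → Code → Code → Code
  | loop : Code → Code

/-- `Runs c x y t`: on input `x` the program `c` halts with output `y` after `t` steps. Every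
instruction is charged at least the size of the data that it reads or writes, so that the step
count agrees with that of a Turing machine up to a polynomial. -/
inductive Runs : Code → Data → Data → ℕ → Prop
  | id (x : Data) : Runs Code.id x x x.size
  | nil (x : Data) : Runs Code.nil x Data.nil 1
  | fst (x : Data) : Runs Code.fst x x.fst x.size
  | snd (x : Data) : Runs Code.snd x x.snd x.size
  | pair {f g : Code} {x y z : Data} {s t : ℕ} :
      Runs f x y s → Runs g x z t → Runs (Code.pair f g) x (Data.node y z) (s + t + x.size)
  | comp {f g : Code} {x y z : Data} {s t : ℕ} :
      Runs f x y s → Runs g y z t → Runs (Code.comp g f) x z (s + t)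
  | ite_node {c f g : Code} {x a b y : Data} {s t : ℕ} :
      Runs c x (Data.node a b) s → Runs f x y t → Runs (Code.ite c f g) x y (s + t + x.size)
  | ite_nil {c f g : Code} {x y : Data} {s t : ℕ} :
      Runs c x Data.nil s → Runs g x y t → Runs (Code.ite c f g) x y (s + t + x.size)
  | loop_done {f : Code} {x : Data} : x.fst = Data.nil → Runs (Code.loop f) x x x.size
  | loop_step {f : Code} {x y z : Data} {s t : ℕ} : x.fst ≠ Data.nil →
      Runs f x y s → Runs (Code.loop f) y z t → Runs (Code.loop f) x z (s + t + x.size)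

/-- A function is computable in polynomial time. -/
def PolyTime (F : Data → Data) : Prop :=
  ∃ (c : Code) (p : Polynomial ℕ), ∀ x : Data, ∃ t : ℕ, t ≤ p.eval x.size ∧ Runs c x (F x) t

/-! ### Probability -/

/-- Negligible functions of the security parameter. -/
def Negligible (f : ℕ → ℝ) : Prop :=
  Asymptotics.SuperpolynomialDecay Filter.atTop (fun n : ℕ => (n : ℝ)) f

/-- A string of `k` independent fair coin tosses. -/
noncomputable def randomBits (k : ℕ) : PMF (List Bool) :=
  (PMF.uniformOfFintype (Fin k → Bool)).map List.ofFn

noncomputable def coin : PMF Bool := PMF.uniformOfFintype Bool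

open Classical in
/-- The uniform distribution on a finite set (a dummy value for the empty set, which is never
sampled in the games below). -/
noncomputable def unif (S : Finset Data) : PMF Data :=
  if h : S.Nonempty then PMF.uniformOfFinset S h else PMF.pure Data.nil

/-- The statistical distance of `P` and `Q` is at most `ε`. -/
def StatClose (ε : ℝ) (P Q : PMF Data) : Prop :=
  ∀ T : Set Data, |(P.toOuterMeasure T).toReal - (Q.toOuterMeasure T).toReal| ≤ ε

/-- Probabilistic polynomial time for a randomized algorithm which, for the security parameter `n`
and the input `x`, has the output distribution `P`; the relation `spec n x P` lists its legitimate
inputs together with their output distributions. Outputs have polynomial length, and the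
distribution is produced from polynomially many fair coins in polynomial time. Since, for instance,
the uniform distribution on three elements cannot be produced exactly from a bounded number of fair
coins, a negligible statistical error is tolerated. -/
def PPT (spec : ℕ → Data → PMF Data → Prop) : Prop :=
  ∃ F : Data → Data, PolyTime F ∧
    ∃ (l q : Polynomial ℕ) (ε : ℕ → ℝ), Negligible ε ∧
      ∀ n x P, spec n x P →
        (∀ y ∈ P.support, y.size ≤ q.eval (n + x.size)) ∧
        StatClose (ε n)
          ((randomBits (l.eval (n + x.size))).map fun r =>
            F (Data.list [Data.unary n, x, Data.bits r])) P

/-! ### Interactive machines -/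

/-- `Reach step k x i s`: on input `x`, a machine with the transition function `step`, tossing `k`
coins in each round, can be in state `s` after `i` rounds, for some answers of its oracles. -/
inductive Reach (step : Data → Data) (k : ℕ) (x : Data) : ℕ → Data → Prop
  | zero : Reach step k x 0 Data.nil
  | succ {i : ℕ} {s : Data} (ans : Data) (r : List Bool) : Reach step k x i s → r.length = k →
      Reach step k x (i + 1) (step (Data.list [x, s, ans, Data.bits r])).fst

/-- A probabilistic polynomial-time oracle machine. In each of its `rounds` many rounds it computes,
from its input `x`, its state, the last oracle answer and fresh coins, a new state and the next
oracle query; `finish` then computes the final state and the output in the same way. Each round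
takes polynomial time, the numbers of rounds and of coins per round are polynomial in the security
parameter `n`, and the length of all states, queries and outputs is bounded by a polynomial in `n`
and the length of the input, no matter what the oracles answer. -/
structure Machine where
  step : Data → Data
  finish : Data → Data
  rounds : Polynomial ℕ
  coins : Polynomial ℕ
  space : Polynomial ℕ
  step_poly : PolyTime step
  finish_poly : PolyTime finish
  step_size : ∀ (n : ℕ) (x : Data) (i : ℕ) (s : Data), i < rounds.eval n →
    Reach step (coins.eval n) x i s → ∀ (ans : Data) (r : List Bool), r.length = coins.eval n →
      (step (Data.list [x, s, ans, Data.bits r])).size ≤ space.eval (n + x.size)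
  finish_size : ∀ (n : ℕ) (x : Data) (s : Data),
    Reach step (coins.eval n) x (rounds.eval n) s →
    ∀ (ans : Data) (r : List Bool), r.length = coins.eval n →
      (finish (Data.list [x, s, ans, Data.bits r])).size ≤ space.eval (n + x.size)

/-- The result of a run: the state handed on, the output, and the list of all oracle queries. -/
structure Outcome where
  state : Data
  out : Data
  log : List Data

/-- The run of a machine with the (randomized) oracle `O` through the given number of remaining
rounds, from a state, a last answer and a list of earlier queries. -/
noncomputable def Machine.loop (A : Machine) (n : ℕ) (x : Data) (O : Data → PMF Data) :
    ℕ → Data → Data → List Data → PMF Outcome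
  | 0, s, ans, L =>
      (randomBits (A.coins.eval n)).map fun r =>
        ⟨(A.finish (Data.list [x, s, ans, Data.bits r])).fst,
         (A.finish (Data.list [x, s, ans, Data.bits r])).snd, L⟩
  | i + 1, s, ans, L =>
      (randomBits (A.coins.eval n)).bind fun r =>
        (O (A.step (Data.list [x, s, ans, Data.bits r])).snd).bind fun ans' =>
          A.loop n x O i (A.step (Data.list [x, s, ans, Data.bits r])).fst ans'
            ((A.step (Data.list [x, s, ans, Data.bits r])).snd :: L)

/-- The complete run on input `x`. -/
noncomputable def Machine.run (A : Machine) (n : ℕ) (x : Data) (O : Data → PMF Data) :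
    PMF Outcome :=
  A.loop n x O (A.rounds.eval n) Data.nil Data.nil []

/-- A two-phase adversary. -/
structure Adversary where
  first : Machine
  second : Machine

/-- The query "key for `f`". -/
def keyQuery (f : Data) : Data := Data.node Data.nil f

/-- The oracles of an adversary, as one oracle: a query `keyQuery f` is answered according to
`key f`, a query `node (node _ _) (node f c)` is the query `(f, c)` to the second oracle and is
answered according to `aux f c`. All other queries, among them the empty query, are answered
by `nil`. -/
noncomputable def oracle (key : Data → PMF (Option Data)) (aux : Data → Data → PMF (Option Data)) :
    Data → PMF Data
  | Data.node Data.nil f => (key f).map Data.ofOption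
  | Data.node (Data.node _ _) (Data.node f c) => (aux f c).map Data.ofOption
  | _ => PMF.pure Data.nil

/-- The oracle that always answers `⊥`. -/
noncomputable def noOracle : Data → Data → PMF (Option Data) := fun _ _ => PMF.pure none

/-- The advantage in an experiment with a Boolean outcome. -/
noncomputable def advantage (P : PMF Bool) : ℝ := |(P true).toReal - 1 / 2|

/-! ### Groups inside sets of data -/

def IsIdentity (S : Set Data) (op : Data → Data → Data) (e : Data) : Prop :=
  e ∈ S ∧ ∀ x ∈ S, op e x = x ∧ op x e = x

/-- `S` is a group under the operation `op`. -/
def IsGroupOn (S : Set Data) (op : Data → Data → Data) : Prop :=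
  (∀ x ∈ S, ∀ y ∈ S, op x y ∈ S) ∧
  (∀ x ∈ S, ∀ y ∈ S, ∀ z ∈ S, op (op x y) z = op x (op y z)) ∧
  ∃ e, IsIdentity S op e ∧ ∀ x ∈ S, ∃ y ∈ S, op x y = e ∧ op y x = e

/-! ### The interactive splitting oracle-assisted subgroup membership problem -/

/-- The data of a family of groups with trapdoor. `gen n` outputs a public description `d` of the
ambient set `Elt n d`, its operation `mul n d`, the index set `Idx n d` and the family of triples
`(Grp, Sub, Rep)`, together with a trapdoor `k`. From the trapdoor, `key n d k i` produces a
description of a function that solves the splitting problem in the `i`-th group. -/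
structure GroupGen where
  gen : ℕ → PMF (Data × Data)
  Elt : ℕ → Data → Finset Data
  mul : ℕ → Data → Data → Data → Data
  Idx : ℕ → Data → Set Data
  Grp : ℕ → Data → Data → Data → Finset Data
  Sub : ℕ → Data → Data → Data → Finset Data
  Rep : ℕ → Data → Data → Data → Finset Data
  key : ℕ → Data → Data → Data → PMF Data

namespace GroupGen

variable (G : GroupGen)

/-- `c = r * ν` with `r` a representative and `ν` in the subgroup. -/
def Splits (n : ℕ) (d k i c r ν : Data) : Prop :=
  r ∈ G.Rep n d k i ∧ ν ∈ G.Sub n d k i ∧ G.mul n d r ν = c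

/-- The requirements on a family of groups with trapdoor. -/
structure IsSplittingFamily : Prop where
  gen_ppt : PPT fun n x P => x = Data.nil ∧ P = (G.gen n).map fun z => Data.node z.1 z.2
  key_ppt : PPT fun n x P => ∃ d k i, (d, k) ∈ (G.gen n).support ∧ i ∈ G.Idx n d ∧
    x = Data.list [d, k, i] ∧ P = G.key n d k i
  mul_mem : ∀ n d k, (d, k) ∈ (G.gen n).support →
    ∀ x ∈ G.Elt n d, ∀ y ∈ G.Elt n d, G.mul n d x y ∈ G.Elt n d
  grp_subset : ∀ n d k, (d, k) ∈ (G.gen n).support → ∀ i ∈ G.Idx n d,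
    G.Grp n d k i ⊆ G.Elt n d
  grp_group : ∀ n d k, (d, k) ∈ (G.gen n).support → ∀ i ∈ G.Idx n d,
    IsGroupOn (G.Grp n d k i) (G.mul n d) ∧ 1 < (G.Grp n d k i).card
  sub_group : ∀ n d k, (d, k) ∈ (G.gen n).support → ∀ i ∈ G.Idx n d,
    G.Sub n d k i ⊂ G.Grp n d k i ∧
    IsGroupOn (G.Sub n d k i) (G.mul n d) ∧ 1 < (G.Sub n d k i).card
  rep_subset : ∀ n d k, (d, k) ∈ (G.gen n).support → ∀ i ∈ G.Idx n d,
    G.Rep n d k i ⊆ G.Grp n d k i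
  splits_iff : ∀ n d k, (d, k) ∈ (G.gen n).support → ∀ i ∈ G.Idx n d,
    (∀ c r ν, G.Splits n d k i c r ν → c ∈ G.Grp n d k i) ∧
    ∀ c ∈ G.Grp n d k i, ∃! z : Data × Data, G.Splits n d k i c z.1 z.2
  rep_card : ∀ n d k, (d, k) ∈ (G.gen n).support → ∀ i ∈ G.Idx n d, ∀ j ∈ G.Idx n d,
    (G.Rep n d k i).card = (G.Rep n d k j).card
  /-- The keys are descriptions of efficient functions that solve the splitting problem. -/
  split_poly : ∃ F : Data → Data, PolyTime F ∧
    ∀ n d k, (d, k) ∈ (G.gen n).support → ∀ i ∈ G.Idx n d, ∀ κ ∈ (G.key n d k i).support,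
      ∀ c r ν, G.Splits n d k i c r ν →
        F (Data.list [Data.unary n, d, i, κ, c]) = Data.node r ν

open Classical in
/-- The splitting `σ_i(c) = (r, ν)` of an element `c` of the `i`-th group, and `⊥` for others. -/
noncomputable def split (n : ℕ) (d k i c : Data) : Option Data :=
  if h : c ∈ G.Grp n d k i ∧ ∃ z : Data × Data, G.Splits n d k i c z.1 z.2 then
    some (Data.node h.2.choose.1 h.2.choose.2)
  else none

open Classical in
/-- The oracles of the first phase: keys for arbitrary indices, and the splitting oracle. -/
noncomputable def oracle1 (n : ℕ) (d k : Data) : Data → PMF Data :=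
  oracle (fun i => if i ∈ G.Idx n d then (G.key n d k i).map some else PMF.pure none)
    (fun i c => PMF.pure (if i ∈ G.Idx n d then G.split n d k i c else none))

open Classical in
/-- The oracle of the second phase: keys for the indices whose groups do not contain the
challenge `c`. -/
noncomputable def oracle2 (n : ℕ) (d k c : Data) : Data → PMF Data :=
  oracle (fun i => if i ∈ G.Idx n d ∧ c ∉ G.Grp n d k i then (G.key n d k i).map some
      else PMF.pure none)
    noOracle

noncomputable def phase1 (A : Adversary) (n : ℕ) (d k : Data) : PMF Outcome :=
  A.first.run n (Data.list [Data.unary n, d]) (G.oracle1 n d k)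

/-- In the first phase the adversary always outputs the index of a group which is disjoint from the
groups of all the indices whose keys it has obtained. -/
def Admissible (A : Adversary) : Prop :=
  ∀ n d k, (d, k) ∈ (G.gen n).support → ∀ z ∈ (G.phase1 A n d k).support,
    z.out ∈ G.Idx n d ∧
    ∀ j ∈ G.Idx n d, keyQuery j ∈ z.log → Disjoint (G.Grp n d k z.out) (G.Grp n d k j)

noncomputable def experiment (A : Adversary) (n : ℕ) : PMF Bool := do
  let g ← G.gen n
  let z ← G.phase1 A n g.1 g.2
  let b ← coin
  let c ← unif (if b then G.Grp n g.1 g.2 z.out else G.Sub n g.1 g.2 z.out)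
  let w ← A.second.run n (Data.list [Data.unary n, g.1, z.state, c]) (G.oracle2 n g.1 g.2 c)
  pure (w.out.toBool == b)

/-- The interactive splitting oracle-assisted subgroup membership problem is hard relative to the
generator: every admissible adversary has negligible advantage. -/
def ISOAPHard : Prop :=
  ∀ A : Adversary, G.Admissible A → Negligible fun n => advantage (G.experiment A n)

end GroupGen

/-! ### Predicate encryption -/

/-- The algorithms and spaces of a predicate encryption scheme. All spaces may depend on the
security parameter `n` and the public parameters `pp`; `sat n pp f a` means `f(a) = 1`, and
`decrypt` returns `none` for `⊥`. -/
structure PEScheme where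
  Msg : ℕ → Data → Finset Data
  Attr : ℕ → Data → Set Data
  Pred : ℕ → Data → Set Data
  sat : ℕ → Data → Data → Data → Prop
  Ctxt : ℕ → Data → Finset Data
  setup : ℕ → PMF (Data × Data)
  keyGen : ℕ → Data → Data → Data → PMF Data
  encrypt : ℕ → Data → Data → Data → PMF Data
  decrypt : ℕ → Data → Data → Data → Option Data

namespace PEScheme

variable (E : PEScheme)

/-- `(pp, msk)` is a possible output of the setup algorithm. -/
def Params (n : ℕ) (pp msk : Data) : Prop := (pp, msk) ∈ (E.setup n).support

/-- `f` is a predicate of the scheme with non-empty support. -/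
def Satisfiable (n : ℕ) (pp f : Data) : Prop :=
  f ∈ E.Pred n pp ∧ ∃ a ∈ E.Attr n pp, E.sat n pp f a

/-- The four algorithms are efficient, and decryption is correct: an encryption of `m` under the
attribute `a` is decrypted by a key for `f` to `m` if `f(a) = 1` and to `⊥` if `f(a) = 0`. -/
structure IsPE : Prop where
  setup_ppt : PPT fun n x P => x = Data.nil ∧ P = (E.setup n).map fun z => Data.node z.1 z.2
  keyGen_ppt : PPT fun n x P => ∃ pp msk f, E.Params n pp msk ∧ f ∈ E.Pred n pp ∧
    x = Data.list [pp, msk, f] ∧ P = E.keyGen n pp msk f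
  encrypt_ppt : PPT fun n x P => ∃ pp msk a m, E.Params n pp msk ∧ a ∈ E.Attr n pp ∧
    m ∈ E.Msg n pp ∧ x = Data.list [pp, a, m] ∧ P = E.encrypt n pp a m
  decrypt_poly : ∃ F : Data → Data, PolyTime F ∧
    ∀ n pp msk, E.Params n pp msk → ∀ f ∈ E.Pred n pp, ∀ sk ∈ (E.keyGen n pp msk f).support,
      ∀ c, F (Data.list [Data.unary n, pp, sk, c]) = Data.ofOption (E.decrypt n pp sk c)
  decrypt_mem : ∀ n pp msk, E.Params n pp msk → ∀ f ∈ E.Pred n pp,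
    ∀ sk ∈ (E.keyGen n pp msk f).support, ∀ c m, E.decrypt n pp sk c = some m →
      c ∈ E.Ctxt n pp ∧ m ∈ E.Msg n pp
  encrypt_mem : ∀ n pp msk, E.Params n pp msk → ∀ a ∈ E.Attr n pp, ∀ m ∈ E.Msg n pp,
    ∀ c ∈ (E.encrypt n pp a m).support, c ∈ E.Ctxt n pp
  correct : ∀ n pp msk, E.Params n pp msk → ∀ f ∈ E.Pred n pp,
    ∀ sk ∈ (E.keyGen n pp msk f).support, ∀ a ∈ E.Attr n pp, ∀ m ∈ E.Msg n pp,
      ∀ c ∈ (E.encrypt n pp a m).support,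
        (E.sat n pp f a → E.decrypt n pp sk c = some m) ∧
        (¬ E.sat n pp f a → E.decrypt n pp sk c = none)

open Classical in
/-- The restricted ciphertext space of `f`: the ciphertexts that a key for `f` does not decrypt
to `⊥`. -/
noncomputable def Restricted (n : ℕ) (pp msk f : Data) : Finset Data :=
  (E.Ctxt n pp).filter fun c =>
    ∃ sk ∈ (E.keyGen n pp msk f).support, E.decrypt n pp sk c ≠ none

open Classical in
/-- The elements of the restricted ciphertext space that are encryptions under attributes in the
support of `f`. -/
noncomputable def Honest (n : ℕ) (pp msk f : Data) : Finset Data :=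
  (E.Restricted n pp msk f).filter fun c =>
    ∃ a ∈ E.Attr n pp, E.sat n pp f a ∧ ∃ m ∈ E.Msg n pp, c ∈ (E.encrypt n pp a m).support

open Classical in
/-- A key generation oracle for the predicates with the property `ok`. -/
noncomputable def keyOracle (n : ℕ) (pp msk : Data) (ok : Data → Prop) (f : Data) :
    PMF (Option Data) :=
  if f ∈ E.Pred n pp ∧ ok f then (E.keyGen n pp msk f).map some else PMF.pure none

open Classical in
/-- The decryption oracle: it decrypts `c` with a key for `f`. -/
noncomputable def decOracle (n : ℕ) (pp msk : Data) (f c : Data) : PMF (Option Data) :=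
  if f ∈ E.Pred n pp then (E.keyGen n pp msk f).map fun sk => E.decrypt n pp sk c
  else PMF.pure none

/-! #### IND-AD-CCA1 security -/

noncomputable def ccaPhase1 (A : Adversary) (n : ℕ) (pp msk : Data) : PMF Outcome :=
  A.first.run n (Data.list [Data.unary n, pp])
    (oracle (E.keyOracle n pp msk fun _ => True) (E.decOracle n pp msk))

/-- After the first phase the adversary always outputs a triple `(a, m₀, m₁)` of a target attribute
and two messages, such that `f(a) = 0` for all predicates `f` whose keys it has obtained. -/
def CCAAdmissible (A : Adversary) : Prop :=
  ∀ n pp msk, E.Params n pp msk → ∀ z ∈ (E.ccaPhase1 A n pp msk).support,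
    ∃ a ∈ E.Attr n pp, ∃ m₀ ∈ E.Msg n pp, ∃ m₁ ∈ E.Msg n pp, z.out = Data.list [a, m₀, m₁] ∧
      ∀ f ∈ E.Pred n pp, keyQuery f ∈ z.log → ¬ E.sat n pp f a

/-- The experiment: the target attribute is chosen adaptively, key queries are possible in both
phases (in the second one for predicates that the target attribute does not satisfy), decryption
queries in the first phase only. -/
noncomputable def ccaExperiment (A : Adversary) (n : ℕ) : PMF Bool := do
  let g ← E.setup n
  let z ← E.ccaPhase1 A n g.1 g.2
  let b ← coin
  let c ← E.encrypt n g.1 z.out.fst (if b then z.out.snd.snd.fst else z.out.snd.fst)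
  let w ← A.second.run n (Data.list [Data.unary n, g.1, z.state, c])
    (oracle (E.keyOracle n g.1 g.2 fun f => ¬ E.sat n g.1 f z.out.fst) noOracle)
  pure (w.out.toBool == b)

def IND_AD_CCA1 : Prop :=
  ∀ A : Adversary, E.CCAAdmissible A → Negligible fun n => advantage (E.ccaExperiment A n)

/-! #### Indistinguishability of honest ciphertexts from the restricted ciphertext space -/

noncomputable def ctPhase1 (A : Adversary) (n : ℕ) (pp msk : Data) : PMF Outcome :=
  A.first.run n (Data.list [Data.unary n, pp])
    (oracle (E.keyOracle n pp msk fun _ => True) noOracle)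

/-- After the first phase the distinguisher always outputs a predicate with non-empty support. -/
def CTAdmissible (A : Adversary) : Prop :=
  ∀ n pp msk, E.Params n pp msk → ∀ z ∈ (E.ctPhase1 A n pp msk).support,
    E.Satisfiable n pp z.out

/-- Given the public parameters, a predicate `f`, a key for `f` and any set of further keys (all
chosen adaptively by the distinguisher), distinguish a uniform element of the restricted ciphertext
space of `f` from a uniform honest ciphertext. -/
noncomputable def ctExperiment (A : Adversary) (n : ℕ) : PMF Bool := do
  let g ← E.setup n
  let z ← E.ctPhase1 A n g.1 g.2
  let sk ← E.keyGen n g.1 g.2 z.out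
  let b ← coin
  let c ← unif (if b then E.Restricted n g.1 g.2 z.out else E.Honest n g.1 g.2 z.out)
  let w ← A.second.run n (Data.list [Data.unary n, g.1, z.state, Data.list [sk, c]])
    (oracle (E.keyOracle n g.1 g.2 fun _ => True) noOracle)
  pure (w.out.toBool == b)

def IND_CT : Prop :=
  ∀ A : Adversary, E.CTAdmissible A → Negligible fun n => advantage (E.ctExperiment A n)

/-! #### Group-homomorphic and generic shift-type schemes -/

/-- Group-homomorphic predicate encryption schemes. -/
structure GroupHomomorphic where
  msgMul : ℕ → Data → Data → Data → Data
  mul : ℕ → Data → Data → Data → Data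
  τ : ℕ → Data → Data → Data
  msg_group : ∀ n pp msk, E.Params n pp msk →
    IsGroupOn (E.Msg n pp) (msgMul n pp) ∧ 1 < (E.Msg n pp).card
  mul_mem : ∀ n pp msk, E.Params n pp msk →
    ∀ x ∈ E.Ctxt n pp, ∀ y ∈ E.Ctxt n pp, mul n pp x y ∈ E.Ctxt n pp
  /-- The decryption function of `f` does not depend on the choice of the key for `f`. -/
  decrypt_eq : ∀ n pp msk, E.Params n pp msk → ∀ f, E.Satisfiable n pp f →
    ∀ sk ∈ (E.keyGen n pp msk f).support, ∀ sk' ∈ (E.keyGen n pp msk f).support,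
      ∀ c ∈ E.Ctxt n pp, E.decrypt n pp sk c = E.decrypt n pp sk' c
  restricted_group : ∀ n pp msk, E.Params n pp msk → ∀ f, E.Satisfiable n pp f →
    IsGroupOn (E.Restricted n pp msk f) (mul n pp) ∧ 1 < (E.Restricted n pp msk f).card
  honest_group : ∀ n pp msk, E.Params n pp msk → ∀ f, E.Satisfiable n pp f →
    IsGroupOn (E.Honest n pp msk f) (mul n pp)
  decrypt_surj : ∀ n pp msk, E.Params n pp msk → ∀ f, E.Satisfiable n pp f →
    ∀ sk ∈ (E.keyGen n pp msk f).support, ∀ m ∈ E.Msg n pp,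
      ∃ c ∈ E.Restricted n pp msk f, E.decrypt n pp sk c = some m
  decrypt_mul : ∀ n pp msk, E.Params n pp msk → ∀ f, E.Satisfiable n pp f →
    ∀ sk ∈ (E.keyGen n pp msk f).support,
    ∀ c ∈ E.Restricted n pp msk f, ∀ c' ∈ E.Restricted n pp msk f, ∀ m m',
      E.decrypt n pp sk c = some m → E.decrypt n pp sk c' = some m' →
        E.decrypt n pp sk (mul n pp c c') = some (msgMul n pp m m')
  indist : E.IND_CT
  τ_poly : ∃ F : Data → Data, PolyTime F ∧ ∀ n pp msk, E.Params n pp msk →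
    ∀ a ∈ E.Attr n pp, F (Data.list [Data.unary n, pp, a]) = τ n pp a
  τ_mem : ∀ n pp msk, E.Params n pp msk → ∀ a ∈ E.Attr n pp, τ n pp a ∈ E.Pred n pp
  τ_spec : ∀ n pp msk, E.Params n pp msk → ∀ a ∈ E.Attr n pp, ∀ a' ∈ E.Attr n pp,
    E.sat n pp (τ n pp a) a' → ∀ g ∈ E.Pred n pp, (E.sat n pp g a' ↔ E.sat n pp g a)

open Classical in
/-- The kernel of decryption on the restricted ciphertext space of `f`: the ciphertexts that
decrypt to the identity of the message group. -/
noncomputable def GroupHomomorphic.Ker {E : PEScheme} (H : E.GroupHomomorphic) (n : ℕ)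
    (pp msk f : Data) : Finset Data :=
  (E.Restricted n pp msk f).filter fun c =>
    ∃ sk ∈ (E.keyGen n pp msk f).support, ∃ m, E.decrypt n pp sk c = some m ∧
      IsIdentity (E.Msg n pp) (H.msgMul n pp) m

/-- Generic shift-type (GIFT) predicate encryption schemes. The representatives of `f` are the
ciphertexts `ψ n pp f m`, for messages `m`. -/
structure GIFT extends E.GroupHomomorphic where
  N : ℕ → Data → Data → Finset Data
  ψ : ℕ → Data → Data → Data → Data
  /-- `N` is a non-trivial proper subgroup of the group of honest ciphertexts. -/
  N_group : ∀ n pp msk, E.Params n pp msk → ∀ f ∈ E.Pred n pp,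
    N n pp f ⊂ E.Honest n pp msk f ∧ IsGroupOn (N n pp f) (mul n pp) ∧ 1 < (N n pp f).card
  /-- The subgroup is normal. -/
  N_normal : ∀ n pp msk, E.Params n pp msk → ∀ f ∈ E.Pred n pp,
    ∀ c ∈ E.Honest n pp msk f, ∀ ν ∈ N n pp f, ∃ ν' ∈ N n pp f, mul n pp c ν = mul n pp ν' c
  /-- `ψ` is a bijection from the messages to a system of representatives of the cosets of `N`. -/
  ψ_mem : ∀ n pp msk, E.Params n pp msk → ∀ f ∈ E.Pred n pp, ∀ m ∈ E.Msg n pp,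
    ψ n pp f m ∈ E.Honest n pp msk f
  ψ_rep : ∀ n pp msk, E.Params n pp msk → ∀ f ∈ E.Pred n pp, ∀ c ∈ E.Honest n pp msk f,
    ∃! m, m ∈ E.Msg n pp ∧ ∃ ν ∈ N n pp f, c = mul n pp (ψ n pp f m) ν
  /-- `ψ` is a homomorphism modulo `N`. -/
  ψ_mul : ∀ n pp msk, E.Params n pp msk → ∀ f ∈ E.Pred n pp,
    ∀ m ∈ E.Msg n pp, ∀ m' ∈ E.Msg n pp, ∃ ν ∈ N n pp f,
      mul n pp (ψ n pp f m) (ψ n pp f m') = mul n pp (ψ n pp f (msgMul n pp m m')) ν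
  /-- Encryption of `m` under `a`: shift a uniform element of `N` by the representative of `m`. -/
  encrypt_eq : ∀ n pp msk, E.Params n pp msk → ∀ a ∈ E.Attr n pp, ∀ m ∈ E.Msg n pp,
    E.encrypt n pp a m =
      (unif (N n pp (τ n pp a))).map fun ν => mul n pp (ψ n pp (τ n pp a) m) ν
  /-- Decryption: write `c = r * ν` with `r` a representative, and return the message of `r`. -/
  N_subset_ker : ∀ n pp msk, E.Params n pp msk → ∀ f ∈ E.Pred n pp,
    N n pp f ⊆ toGroupHomomorphic.Ker n pp msk f
  decrypt_iff : ∀ n pp msk, E.Params n pp msk → ∀ f ∈ E.Pred n pp,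
    ∀ sk ∈ (E.keyGen n pp msk f).support, ∀ c ∈ E.Restricted n pp msk f, ∀ m,
      E.decrypt n pp sk c = some m ↔
        m ∈ E.Msg n pp ∧
          ∃ ν ∈ toGroupHomomorphic.Ker n pp msk f, c = mul n pp (ψ n pp f m) ν
  /-- `ψ` and its inverse on representatives are efficient. -/
  ψ_poly : ∃ F : Data → Data, PolyTime F ∧ ∀ n pp msk, E.Params n pp msk →
    ∀ f ∈ E.Pred n pp, ∀ m ∈ E.Msg n pp,
      F (Data.list [Data.unary n, pp, f, m]) = ψ n pp f m
  ψ_inv_poly : ∃ F : Data → Data, PolyTime F ∧ ∀ n pp msk, E.Params n pp msk →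
    ∀ f ∈ E.Pred n pp, ∀ m ∈ E.Msg n pp,
      F (Data.list [Data.unary n, pp, f, ψ n pp f m]) = m
  /-- Multiplication and inversion in the restricted ciphertext spaces are efficient. -/
  mul_poly : ∃ F : Data → Data, PolyTime F ∧ ∀ n pp msk, E.Params n pp msk →
    ∀ f ∈ E.Pred n pp, ∀ c ∈ E.Restricted n pp msk f, ∀ c' ∈ E.Restricted n pp msk f,
      F (Data.list [Data.unary n, pp, c, c']) = mul n pp c c'
  inv_poly : ∃ F : Data → Data, PolyTime F ∧ ∀ n pp msk, E.Params n pp msk →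
    ∀ f ∈ E.Pred n pp, ∀ c ∈ E.Restricted n pp msk f,
      F (Data.list [Data.unary n, pp, f, c]) ∈ E.Restricted n pp msk f ∧
      IsIdentity (E.Restricted n pp msk f) (mul n pp)
        (mul n pp (F (Data.list [Data.unary n, pp, f, c])) c)
  /-- An attribute in the support of a given predicate can be found efficiently. -/
  attr_poly : ∃ F : Data → Data, PolyTime F ∧ ∀ n pp msk, E.Params n pp msk →
    ∀ f ∈ E.Pred n pp, F (Data.list [Data.unary n, pp, f]) ∈ E.Attr n pp ∧
      E.sat n pp f (F (Data.list [Data.unary n, pp, f]))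
  /-- Random messages can be sampled efficiently, up to a negligible statistical error. -/
  msg_sample : ∃ F : Data → Data, PolyTime F ∧ ∃ (l : Polynomial ℕ) (ε : ℕ → ℝ), Negligible ε ∧
    ∀ n pp msk, E.Params n pp msk →
      (∀ r : List Bool, r.length = l.eval n →
        F (Data.list [Data.unary n, pp, Data.bits r]) ∈ E.Msg n pp) ∧
      StatClose (ε n)
        ((randomBits (l.eval n)).map fun r => F (Data.list [Data.unary n, pp, Data.bits r]))
        (unif (E.Msg n pp))

open Classical in
/-- The family of groups derived from a GIFT scheme: it is indexed by the predicates `f`, the groups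
are the restricted ciphertext spaces, with the kernels of decryption as subgroups and the
ciphertexts `ψ n pp f m` as representatives. The public parameters are the public description, the
master secret key is the trapdoor, and the secret key for `f` describes the splitting function. -/
noncomputable def GIFT.groupGen {E : PEScheme} (H : E.GIFT) : GroupGen where
  gen := E.setup
  Elt := E.Ctxt
  mul := H.mul
  Idx := E.Pred
  Grp := E.Restricted
  Sub := H.toGroupHomomorphic.Ker
  Rep := fun n pp _ f => (E.Msg n pp).image (H.ψ n pp f)
  key := E.keyGen

end PEScheme

end PredEnc

/-!
The public parameters of a generic shift-type scheme let everyone pass between decryption and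
splitting: a ciphertext `c` of `m` in the restricted ciphertext space of `f` splits as `ψ m * ν` with
`ν` in the kernel of decryption, `m` determines `ψ m` and hence `ν`, and `ψ m` determines `m`. This
gives the splitting family (`isSplittingFamily_groupGen`) and exact simulations of the oracles of the
first phases by each other.

Two algebraic facts relate the restrictions on keys. The identity of the group of honest ciphertexts
for `f` is an encryption under (an attribute equivalent to) each attribute in the support of `f`;
therefore all these attributes satisfy the same predicates (`sat_of_sat`), and an honest ciphertext
for `f` lies in the restricted ciphertext space of `g` exactly if `g` is satisfied by the support of
`f` (`honest_mem_restricted_iff`). Two restricted ciphertext spaces with a common element are finite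
groups with a common identity; therefore they are disjoint unless the predicates are satisfied by
common attributes (`disjoint_restricted`, `not_sat_of_disjoint`). Encryption under `a` is the same
for all `f` with `f(a) = 1` (`encrypt_eq_of_sat`): a uniform element of `N` shifted by `ψ m`.

The challenge of the splitting problem is uniform in the restricted ciphertext space or in its
kernel. The indistinguishability assumption on the scheme replaces it by a uniform honest ciphertext
or a uniform element of `N`, where the second replacement uses the map `ψ m * ν ↦ ν`
(`negligible_advantage_iff`). After that, an encryption of `m₀` divided by `ψ m₀` is uniform in `N`,
and an encryption of a random message divided by `ψ m₀` is a uniform honest ciphertext, which yields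
one implication (`isoapHard_of_indCCA`). Conversely, the product of `ψ m` with the challenge is an
encryption of `m` or a uniform honest ciphertext, which does not depend on `m`
(`indCCA_of_isoapHard`).

The reductions are machines: `Machine.translate` simulates a machine behind a translation of its
input, queries, answers and output, `Machine.withCoins` provides additional coins, and
`PolyTime.iterate` is the source of all polynomial-time loops.
-/

namespace PredEnc

/-! ### Polynomial time -/

open Polynomial in
theorem monotone_eval (p : ℕ[X]) : Monotone fun k => p.eval k := by
  intro a b h
  simp only [eval_eq_sum, Polynomial.sum]
  gcongr

namespace Data

@[simp] theorem fst_node (a b : Data) : (node a b).fst = a := rfl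
@[simp] theorem snd_node (a b : Data) : (node a b).snd = b := rfl
@[simp] theorem fst_nil : nil.fst = nil := rfl
@[simp] theorem snd_nil : nil.snd = nil := rfl
@[simp] theorem size_nil : nil.size = 1 := rfl
@[simp] theorem size_node (a b : Data) : (node a b).size = a.size + b.size + 1 := rfl
@[simp] theorem list_nil : list [] = nil := rfl
@[simp] theorem list_cons (a : Data) (l : List Data) : list (a :: l) = node a (list l) := rfl

theorem one_le_size (x : Data) : 1 ≤ x.size := by cases x <;> simp

theorem size_fst_le (x : Data) : x.fst.size ≤ x.size := by cases x <;> simp; omega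

theorem size_snd_le (x : Data) : x.snd.size ≤ x.size := by cases x <;> simp; omega

/-- Case distinction: the second argument if the first is a node, otherwise the third. -/
def ifNode : Data → Data → Data → Data
  | nil, _, y => y
  | node _ _, x, _ => x

@[simp] theorem ifNode_nil (x y : Data) : ifNode nil x y = y := rfl
@[simp] theorem ifNode_node (a b x y : Data) : ifNode (node a b) x y = x := rfl

/-- The length of the right spine, that is, the length of the list that is coded. -/
def len : Data → ℕ
  | nil => 0
  | node _ b => b.len + 1

@[simp] theorem len_nil : nil.len = 0 := rfl
@[simp] theorem len_node (a b : Data) : (node a b).len = b.len + 1 := rfl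

theorem len_le_size (x : Data) : x.len ≤ x.size := by
  induction x with
  | nil => simp
  | node a b _ ih => simp; omega

@[simp] theorem len_unary (k : ℕ) : (unary k).len = k := by
  induction k with
  | zero => rfl
  | succ k ih => simp [unary, ih]

@[simp] theorem size_unary (k : ℕ) : (unary k).size = 2 * k + 1 := by
  induction k with
  | zero => rfl
  | succ k ih => simp [unary, ih]; omega

end Data

theorem Runs.size_le {c : Code} {x y : Data} {t : ℕ} (h : Runs c x y t) : y.size ≤ t := by
  induction h with
  | id x => rfl
  | nil x => rfl
  | fst x => exact x.size_fst_le
  | snd x => exact x.size_snd_le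
  | @pair _ _ x _ _ _ _ _ _ ih₁ ih₂ => have := x.one_le_size; simp; omega
  | comp _ _ _ ih => omega
  | ite_node _ _ _ ih => omega
  | ite_nil _ _ _ ih => omega
  | loop_done _ => rfl
  | loop_step _ _ _ _ ih => omega

attribute [fun_prop] PolyTime

namespace PolyTime

theorem exists_size_le {F : Data → Data} (hF : PolyTime F) :
    ∃ p : Polynomial ℕ, ∀ x, (F x).size ≤ p.eval x.size := by
  obtain ⟨c, p, h⟩ := hF
  exact ⟨p, fun x => let ⟨_, ht, hr⟩ := h x; hr.size_le.trans ht⟩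

@[fun_prop]
theorem id : PolyTime fun x => x :=
  ⟨Code.id, Polynomial.X, fun x => ⟨_, by simp, Runs.id x⟩⟩

@[fun_prop]
theorem comp {F G : Data → Data} (hF : PolyTime F) (hG : PolyTime G) :
    PolyTime fun x => F (G x) := by
  obtain ⟨c, p, hc⟩ := hF
  obtain ⟨d, q, hd⟩ := hG
  refine ⟨Code.comp c d, q + p.comp q, fun x => ?_⟩
  obtain ⟨s, hs, rs⟩ := hd x
  obtain ⟨t, ht, rt⟩ := hc (G x)
  refine ⟨s + t, ?_, Runs.comp rs rt⟩
  have := monotone_eval p (rs.size_le.trans hs)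
  simp only [Polynomial.eval_add, Polynomial.eval_comp] at *
  omega

@[fun_prop]
theorem node {F G : Data → Data} (hF : PolyTime F) (hG : PolyTime G) :
    PolyTime fun x => Data.node (F x) (G x) := by
  obtain ⟨c, p, hc⟩ := hF
  obtain ⟨d, q, hd⟩ := hG
  refine ⟨Code.pair c d, p + q + Polynomial.X, fun x => ?_⟩
  obtain ⟨s, hs, rs⟩ := hc x
  obtain ⟨t, ht, rt⟩ := hd x
  exact ⟨_, by simp; omega, Runs.pair rs rt⟩

@[fun_prop]
theorem const (d : Data) : PolyTime fun _ => d := by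
  induction d with
  | nil => exact ⟨Code.nil, 1, fun x => ⟨_, by simp, Runs.nil x⟩⟩
  | node a b iha ihb => exact node iha ihb

theorem fst' : PolyTime Data.fst :=
  ⟨Code.fst, Polynomial.X, fun x => ⟨_, by simp, Runs.fst x⟩⟩

theorem snd' : PolyTime Data.snd :=
  ⟨Code.snd, Polynomial.X, fun x => ⟨_, by simp, Runs.snd x⟩⟩

@[fun_prop]
theorem fst {F : Data → Data} (hF : PolyTime F) : PolyTime fun x => (F x).fst := fst'.comp hF

@[fun_prop]
theorem snd {F : Data → Data} (hF : PolyTime F) : PolyTime fun x => (F x).snd := snd'.comp hF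

@[fun_prop]
theorem ifNode {C F G : Data → Data} (hC : PolyTime C) (hF : PolyTime F) (hG : PolyTime G) :
    PolyTime fun x => Data.ifNode (C x) (F x) (G x) := by
  obtain ⟨c, p, hc⟩ := hC
  obtain ⟨d, q, hd⟩ := hF
  obtain ⟨e, r, he⟩ := hG
  refine ⟨Code.ite c d e, p + q + r + Polynomial.X, fun x => ?_⟩
  obtain ⟨s, hs, rs⟩ := hc x
  obtain ⟨t, ht, rt⟩ := hd x
  obtain ⟨u, hu, ru⟩ := he x
  cases h : C x with
  | nil =>
    rw [h] at rs
    exact ⟨s + u + x.size, by simp; omega, by simpa [h] using Runs.ite_nil rs ru⟩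
  | node a b =>
    rw [h] at rs
    exact ⟨s + t + x.size, by simp; omega, by simpa [h] using Runs.ite_node rs rt⟩

/-- One pass of the loop code for `F` consumes one element of the list in the first component, so
that the loop computes an iterate of `F`. -/
theorem runs_loop {F : Data → Data} {c : Code} {p : Polynomial ℕ}
    (hc : ∀ x : Data, ∃ t ≤ p.eval x.size, Runs c x (Data.node x.fst.snd (F x.snd)) t)
    (S M : ℕ) (u : Data) : ∀ s : Data, u.size ≤ S → (∀ i ≤ u.len, (F^[i] s).size ≤ M) →
      ∃ t ≤ (u.len + 1) * (p.eval (S + M + 1) + (S + M + 1)),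
        Runs (Code.loop c) (Data.node u s) (Data.node Data.nil (F^[u.len] s)) t := by
  induction u with
  | nil =>
    intro s hS hM
    have := hM 0 le_rfl
    refine ⟨_, ?_, Runs.loop_done rfl⟩
    simp at *
    omega
  | node a b _ ih =>
    intro s hS hM
    obtain ⟨t, ht, rt⟩ := hc (Data.node (Data.node a b) s)
    simp only [Data.size_node, Data.len_node] at hS hM
    obtain ⟨t', ht', rt'⟩ := ih (F s) (by omega) fun i hi => hM (i + 1) (by omega)
    refine ⟨_, ?_, Runs.loop_step (by simp) rt rt'⟩
    have h0 := hM 0 (by omega)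
    simp only [Function.iterate_zero, _root_.id] at h0
    have h1 := monotone_eval p (show (Data.node (Data.node a b) s).size ≤ S + M + 1 by
      simp; omega)
    simp only [Data.len_node, Data.size_node] at *
    rw [add_mul _ 1, one_mul]
    omega

theorem iterate {F C S : Data → Data} (hF : PolyTime F) (hC : PolyTime C) (hS : PolyTime S)
    (b : Polynomial ℕ) (hb : ∀ x, ∀ i ≤ (C x).len, (F^[i] (S x)).size ≤ b.eval x.size) :
    PolyTime fun x => F^[(C x).len] (S x) := by
  have hG : PolyTime fun x => Data.node x.fst.snd (F x.snd) := by fun_prop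
  obtain ⟨c, p, hc⟩ := hG
  obtain ⟨q, hq⟩ := hC.exists_size_le
  have hL : PolyTime fun x => Data.node Data.nil (F^[(C x).len] (S x)) := by
    obtain ⟨d, r, hd⟩ := hC.node hS
    refine ⟨Code.comp (Code.loop c) d, r + (q + 1) * (p.comp (q + b + 1) + (q + b + 1)),
      fun x => ?_⟩
    obtain ⟨t, ht, rt⟩ := hd x
    obtain ⟨t', ht', rt'⟩ := runs_loop hc (q.eval x.size) (b.eval x.size) (C x) (S x) (hq x) (hb x)
    refine ⟨_, ?_, Runs.comp rt rt'⟩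
    have h1 := (Data.len_le_size (C x)).trans (hq x)
    have h2 := Nat.mul_le_mul_right
      (p.eval (q.eval x.size + b.eval x.size + 1) + (q.eval x.size + b.eval x.size + 1))
      (Nat.add_le_add_right h1 1)
    simp only [Polynomial.eval_add, Polynomial.eval_mul, Polynomial.eval_one,
      Polynomial.eval_comp]
    omega
  exact snd'.comp hL

/-- Removing as many elements from a list as another list has. -/
theorem drop {C S : Data → Data} (hC : PolyTime C) (hS : PolyTime S) :
    PolyTime fun x => Data.snd^[(C x).len] (S x) := by
  obtain ⟨p, hp⟩ := hS.exists_size_le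
  refine iterate snd' hC hS p fun x i _ => le_trans ?_ (hp x)
  induction i with
  | zero => rfl
  | succ i ih =>
    rw [Function.iterate_succ_apply']
    exact (Data.size_snd_le _).trans (ih (by omega))

end PolyTime

theorem Data.size_iterate_cons (a : Data) (i : ℕ) (s : Data) :
    ((Data.node a)^[i] s).size = i * (a.size + 1) + s.size := by
  induction i with
  | zero => simp
  | succ i ih => rw [Function.iterate_succ_apply', size_node, ih]; ring

theorem Data.iterate_cons_unary (i k : ℕ) :
    (Data.node Data.nil)^[i] (Data.unary k) = Data.unary (i + k) := by
  induction i with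
  | zero => simp
  | succ i ih =>
    rw [Function.iterate_succ_apply', ih, Nat.add_right_comm]
    rfl

namespace PolyTime

theorem prepend {C S : Data → Data} (hC : PolyTime C) (hS : PolyTime S) :
    PolyTime fun x => (Data.node Data.nil)^[(C x).len] (S x) := by
  obtain ⟨p, hp⟩ := hS.exists_size_le
  obtain ⟨q, hq⟩ := hC.exists_size_le
  refine iterate (by fun_prop) hC hS (2 * q + p) fun x i hi => ?_
  have h1 := hp x
  have h2 := (Data.len_le_size (C x)).trans (hq x)
  have h3 : i * 2 ≤ Polynomial.eval x.size q * 2 := by omega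
  simp only [Data.size_iterate_cons, Data.size_nil, Polynomial.eval_add, Polynomial.eval_mul,
    Polynomial.eval_ofNat]
  omega

theorem unary_add {f g : Data → ℕ} (hf : PolyTime fun x => Data.unary (f x))
    (hg : PolyTime fun x => Data.unary (g x)) : PolyTime fun x => Data.unary (f x + g x) := by
  simpa [Data.iterate_cons_unary] using prepend hf hg

theorem unary_mul {f g : Data → ℕ} (hf : PolyTime fun x => Data.unary (f x))
    (hg : PolyTime fun x => Data.unary (g x)) : PolyTime fun x => Data.unary (f x * g x) := by
  let F : Data → Data := fun s => Data.node s.fst ((Data.node Data.nil)^[s.fst.len] s.snd)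
  have hF : PolyTime F := node (by fun_prop) (prepend (by fun_prop) (by fun_prop))
  have key : ∀ k i, F^[i] (Data.node (Data.unary k) (Data.unary 0)) =
      Data.node (Data.unary k) (Data.unary (i * k)) := by
    intro k i
    induction i with
    | zero => simp
    | succ i ih =>
      rw [Function.iterate_succ_apply', ih]
      simp [F, Data.iterate_cons_unary]
      congr 1
      ring
  obtain ⟨p, hp⟩ := hf.exists_size_le
  obtain ⟨q, hq⟩ := hg.exists_size_le
  have := iterate (S := fun x => Data.node (Data.unary (g x)) (Data.unary 0)) hF hf
    (by fun_prop) (q + 2 * (p * q) + 2) fun x i hi => by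
      have h1 := hp x
      have h2 := hq x
      simp only [Data.size_unary, Data.len_unary] at h1 h2 hi
      have : i * g x ≤ Polynomial.eval x.size p * Polynomial.eval x.size q :=
        Nat.mul_le_mul (by omega) (by omega)
      simp only [key, Data.size_node, Data.size_unary, Polynomial.eval_add, Polynomial.eval_mul,
        Polynomial.eval_ofNat]
      omega
  simpa [key] using this.snd

theorem unary_len {F : Data → Data} (hF : PolyTime F) :
    PolyTime fun x => Data.unary (F x).len := by
  simpa only [Data.iterate_cons_unary, add_zero] using prepend hF (const (Data.unary 0))

theorem unary_eval (p : Polynomial ℕ) {f : Data → ℕ} (hf : PolyTime fun x => Data.unary (f x)) :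
    PolyTime fun x => Data.unary (p.eval (f x)) := by
  induction p using Polynomial.induction_on with
  | C a => simpa using const _
  | add p q hp hq => simpa using unary_add hp hq
  | monomial k a h =>
    have := unary_mul h hf
    simpa [pow_succ, mul_assoc] using this

end PolyTime

/-! ### Probability -/

/-- The probability of the outcome `true`. -/
noncomputable def prob (P : PMF Bool) : ℝ := (P true).toReal

section
variable {α : Type*}

theorem summable_toReal (P : PMF α) : Summable fun a => (P a).toReal :=
  ENNReal.summable_toReal P.tsum_coe_ne_top

theorem tsum_toReal (P : PMF α) : ∑' a, (P a).toReal = 1 := by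
  rw [← ENNReal.tsum_toReal_eq P.apply_ne_top, P.tsum_coe, ENNReal.toReal_one]

theorem prob_nonneg (P : PMF Bool) : 0 ≤ prob P := ENNReal.toReal_nonneg

theorem prob_le_one (P : PMF Bool) : prob P ≤ 1 :=
  ENNReal.toReal_le_of_le_ofReal zero_le_one (by simpa using P.coe_le_one true)

theorem summable_mul_prob (P : PMF α) (K : α → PMF Bool) :
    Summable fun a => (P a).toReal * prob (K a) :=
  (summable_toReal P).of_nonneg_of_le
    (fun _ => mul_nonneg ENNReal.toReal_nonneg (prob_nonneg _))
    fun _ => mul_le_of_le_one_right ENNReal.toReal_nonneg (prob_le_one _)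

theorem prob_bind (P : PMF α) (K : α → PMF Bool) :
    prob (P.bind K) = ∑' a, (P a).toReal * prob (K a) := by
  rw [prob, PMF.bind_apply, ENNReal.tsum_toReal_eq fun a =>
    ENNReal.mul_ne_top (P.apply_ne_top a) ((K a).apply_ne_top _)]
  simp only [ENNReal.toReal_mul, prob]

theorem bind_congr_support {β : Type*} {P : PMF α} {K K' : α → PMF β}
    (h : ∀ a ∈ P.support, K a = K' a) : P.bind K = P.bind K' := by
  ext b
  rw [PMF.bind_apply, PMF.bind_apply]
  refine tsum_congr fun a => ?_
  by_cases ha : a ∈ P.support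
  · rw [h a ha]
  · rw [(P.apply_eq_zero_iff a).2 ha, zero_mul, zero_mul]

theorem map_congr_support {β : Type*} {P : PMF α} {g g' : α → β}
    (h : ∀ a ∈ P.support, g a = g' a) : P.map g = P.map g' :=
  bind_congr_support fun a ha => congrArg PMF.pure (h a ha)

theorem abs_prob_bind_sub_le {P : PMF α} {K K' : α → PMF Bool} {ε : ℝ}
    (h : ∀ a ∈ P.support, |prob (K a) - prob (K' a)| ≤ ε) :
    |prob (P.bind K) - prob (P.bind K')| ≤ ε := by
  have key : ∀ a, ‖(P a).toReal * prob (K a) - (P a).toReal * prob (K' a)‖ ≤ (P a).toReal * ε := by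
    intro a
    rw [← mul_sub, norm_mul, Real.norm_eq_abs, Real.norm_eq_abs, abs_of_nonneg ENNReal.toReal_nonneg]
    by_cases ha : a ∈ P.support
    · exact mul_le_mul_of_nonneg_left (h a ha) ENNReal.toReal_nonneg
    · simp [(P.apply_eq_zero_iff a).2 ha]
  rw [prob_bind, prob_bind, ← (summable_mul_prob P K).tsum_sub (summable_mul_prob P K')]
  refine (tsum_of_norm_bounded ((summable_toReal P).mul_right ε).hasSum key).trans_eq ?_
  rw [tsum_mul_right, tsum_toReal, one_mul]

theorem prob_map_beq (P : PMF Bool) (b : Bool) :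
    prob (P.bind fun w => PMF.pure (w == b)) = if b then prob P else 1 - prob P := by
  have h1 : (P true).toReal + (P false).toReal = 1 := by simpa using tsum_toReal P
  rw [prob_bind, tsum_bool]
  cases b <;> simp [prob]; linarith

/-- The advantage in guessing a coin `b` is half of the difference between the two cases. -/
theorem advantage_bind_coin (P : PMF α) (K : α → Bool → PMF Bool) :
    advantage (P.bind fun a => coin.bind fun b => (K a b).bind fun w => PMF.pure (w == b)) =
      |prob (P.bind fun a => K a true) - prob (P.bind fun a => K a false)| / 2 := by
  have hc : ∀ b, (coin b).toReal = 1 / 2 := by simp [coin]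
  simp only [PMF.bind_comm P coin, ← PMF.bind_bind]
  change |prob _ - 1 / 2| = _
  rw [prob_bind, tsum_bool, hc, hc, prob_map_beq, prob_map_beq, ← abs_two, ← abs_div]
  congr 1
  simp only [Bool.false_eq_true, if_false, if_true, abs_two]
  ring

theorem toReal_toOuterMeasure (P : PMF Data) (T : Set Data) :
    (P.toOuterMeasure T).toReal = ∑' a, T.indicator (fun a => (P a).toReal) a := by
  rw [PMF.toOuterMeasure_apply, ENNReal.tsum_toReal_eq]
  · refine tsum_congr fun a => ?_
    by_cases h : a ∈ T <;> simp [h]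
  · intro a
    by_cases h : a ∈ T <;> simp [h, P.apply_ne_top]

theorem prob_bind_sub_le_of_statClose {ε : ℝ} {P Q : PMF Data} (h : StatClose ε P Q)
    (K : Data → PMF Bool) : prob (P.bind K) - prob (Q.bind K) ≤ ε := by
  -- the difference is largest for the test that accepts where `P` exceeds `Q`
  let T : Set Data := {a | (Q a).toReal ≤ (P a).toReal}
  have hP := (summable_toReal P).indicator T
  have hQ := (summable_toReal Q).indicator T
  rw [prob_bind, prob_bind, ← (summable_mul_prob P K).tsum_sub (summable_mul_prob Q K)]
  refine le_trans ?_ ((le_abs_self _).trans (h T))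
  rw [toReal_toOuterMeasure, toReal_toOuterMeasure, ← hP.tsum_sub hQ]
  refine ((summable_mul_prob P K).sub (summable_mul_prob Q K)).tsum_le_tsum (fun a => ?_) (hP.sub hQ)
  have h0 := prob_nonneg (K a)
  have h1 := prob_le_one (K a)
  by_cases ha : a ∈ T
  · have : (Q a).toReal ≤ (P a).toReal := ha
    simp only [Set.indicator_of_mem ha]
    nlinarith
  · have : (P a).toReal < (Q a).toReal := lt_of_not_ge ha
    simp only [Set.indicator_of_notMem ha]
    nlinarith

theorem abs_prob_bind_sub_le_of_statClose {ε : ℝ} {P Q : PMF Data} (h : StatClose ε P Q)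
    (K : Data → PMF Bool) : |prob (P.bind K) - prob (Q.bind K)| ≤ ε := by
  refine abs_sub_le_iff.2 ⟨prob_bind_sub_le_of_statClose h K,
    prob_bind_sub_le_of_statClose (fun T => ?_) K⟩
  rw [abs_sub_comm]
  exact h T

end

theorem unif_apply {S : Finset Data} (hS : S.Nonempty) (a : Data) [Decidable (a ∈ S)] :
    unif S a = if a ∈ S then (S.card : ENNReal)⁻¹ else 0 := by
  rw [unif, dif_pos hS, PMF.uniformOfFinset_apply]
  congr

theorem mem_support_unif {S : Finset Data} (hS : S.Nonempty) {a : Data} :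
    a ∈ (unif S).support ↔ a ∈ S := by
  rw [unif, dif_pos hS, PMF.mem_support_uniformOfFinset_iff]

theorem eq_unif {P : PMF Data} {S : Finset Data} (h0 : ∀ a ∉ S, P a = 0) (c : ENNReal)
    (hc : ∀ a ∈ S, P a = c) : P = unif S := by
  classical
  have h1 : S.card * c = 1 := by
    rw [← P.tsum_coe, tsum_eq_sum h0, Finset.sum_congr rfl hc, Finset.sum_const, nsmul_eq_mul]
  have hS : S.Nonempty := by
    rw [← Finset.card_pos, Nat.pos_iff_ne_zero]
    rintro h
    simp [h] at h1
  ext a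
  rw [unif_apply hS]
  split_ifs with ha
  · rw [hc a ha]
    exact ENNReal.eq_inv_of_mul_eq_one_left (by rwa [mul_comm] at h1)
  · exact h0 a ha

/-- If every element of `U` is `g a b` for unique `a ∈ S` and `b ∈ T`, then uniform `a` and `b`
yield a uniform element of `U`. -/
theorem unif_eq_bind_map {S T U : Finset Data} (hS : S.Nonempty) (hT : T.Nonempty)
    {g : Data → Data → Data} (hg : ∀ a ∈ S, ∀ b ∈ T, g a b ∈ U)
    (h : ∀ u ∈ U, ∃ a ∈ S, ∃ b ∈ T, g a b = u ∧ ∀ a' ∈ S, ∀ b' ∈ T, g a' b' = u → a' = a ∧ b' = b) :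
    unif U = (unif S).bind fun a => (unif T).map (g a) := by
  classical
  refine (eq_unif (fun u hu => ?_) ((S.card : ENNReal)⁻¹ * (T.card : ENNReal)⁻¹)
    fun u hu => ?_).symm
  · rw [PMF.apply_eq_zero_iff]
    simp only [PMF.mem_support_bind_iff, PMF.mem_support_map_iff, mem_support_unif hS,
      mem_support_unif hT]
    rintro ⟨a, ha, b, hb, rfl⟩
    exact hu (hg a ha b hb)
  · obtain ⟨a, ha, b, hb, hab, huniq⟩ := h u hu
    rw [PMF.bind_apply, tsum_eq_single a]
    · rw [PMF.map_apply, tsum_eq_single b]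
      · rw [if_pos hab.symm, unif_apply hS, unif_apply hT, if_pos ha, if_pos hb]
      · intro b' hb'
        split_ifs with hu'
        · rw [unif_apply hT, if_neg]
          exact fun hT' => hb' (huniq a ha b' hT' hu'.symm).2
        · rfl
    · intro a' ha'
      rw [mul_eq_zero, PMF.apply_eq_zero_iff, PMF.apply_eq_zero_iff, mem_support_unif hS,
        PMF.mem_support_map_iff]
      by_contra! hcon
      obtain ⟨haS, b', hb', e⟩ := hcon
      exact ha' (huniq a' haS b' ((mem_support_unif hT).1 hb') e).1

theorem map_unif_eq_unif {T U : Finset Data} (hT : T.Nonempty)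
    {g : Data → Data} (hg : ∀ b ∈ T, g b ∈ U)
    (h : ∀ u ∈ U, ∃ b ∈ T, g b = u ∧ ∀ b' ∈ T, g b' = u → b' = b) :
    (unif T).map g = unif U := by
  rw [unif_eq_bind_map (S := {Data.nil}) (Finset.singleton_nonempty _) hT (g := fun _ => g)
    (fun _ _ => hg) fun u hu => ?_, PMF.bind_const]
  obtain ⟨b, hb, e, h'⟩ := h u hu
  exact ⟨_, Finset.mem_singleton_self _, b, hb, e, fun a ha b' hb' e' =>
    ⟨Finset.mem_singleton.1 ha, h' b' hb' e'⟩⟩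

theorem mem_support_randomBits {k : ℕ} {r : List Bool} :
    r ∈ (randomBits k).support ↔ r.length = k := by
  rw [randomBits, PMF.mem_support_map_iff]
  constructor
  · rintro ⟨f, -, rfl⟩
    simp
  · rintro rfl
    exact ⟨r.get, by simp, List.ofFn_get r⟩

theorem randomBits_apply {k : ℕ} {r : List Bool} (h : r.length = k) :
    randomBits k r = (2 ^ k)⁻¹ := by
  subst h
  rw [randomBits, PMF.map_apply, tsum_eq_single r.get]
  · simp
  · intro f hf
    rw [if_neg]
    rintro e
    refine hf (List.ofFn_injective ?_)
    rw [← e]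
    simp

/-- A string of `k + l` coins consists of `k` coins, in reverse order, and `l` further coins. -/
theorem randomBits_add (k l : ℕ) :
    (randomBits (k + l)).map (fun r => ((r.take k).reverse, r.drop k)) =
      (randomBits k).bind fun a => (randomBits l).map fun b => (a, b) := by
  ext ⟨a, b⟩
  by_cases h : a.length = k ∧ b.length = l
  · obtain ⟨ha, hb⟩ := h
    rw [PMF.map_apply, tsum_eq_single (a.reverse ++ b), if_pos, PMF.bind_apply, tsum_eq_single a,
      PMF.map_apply, tsum_eq_single b, if_pos rfl, randomBits_apply (by simp [ha, hb]),
      randomBits_apply ha, randomBits_apply hb, pow_add, ENNReal.mul_inv (by simp) (by simp)]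
    · intro b' hb'
      simp [hb'.symm]
    · intro a' ha'
      rw [mul_eq_zero]
      right
      rw [PMF.apply_eq_zero_iff, PMF.mem_support_map_iff]
      rintro ⟨b', -, e⟩
      exact ha' (Prod.mk.inj e).1
    · simp [← ha]
    · intro r hr
      rw [if_neg]
      intro e
      rw [Prod.mk.injEq] at e
      exact hr (by rw [e.1, e.2]; simp)
  · rw [(PMF.apply_eq_zero_iff _ _).2, (PMF.apply_eq_zero_iff _ _).2]
    · simp only [PMF.mem_support_bind_iff, PMF.mem_support_map_iff, mem_support_randomBits,
        Prod.mk.injEq]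
      rintro ⟨a', ha', b', hb', rfl, rfl⟩
      exact h ⟨ha', hb'⟩
    · simp only [PMF.mem_support_map_iff, mem_support_randomBits, Prod.mk.injEq]
      rintro ⟨r, hr, rfl, rfl⟩
      exact h (by simp [hr])

theorem Negligible.mono {f g : ℕ → ℝ} (hf : Negligible f) (h : ∀ n, |g n| ≤ f n) :
    Negligible g :=
  hf.trans_abs_le fun n => (h n).trans (le_abs_self _)

theorem Negligible.add {f g : ℕ → ℝ} (hf : Negligible f) (hg : Negligible g) :
    Negligible fun n => f n + g n :=
  Asymptotics.SuperpolynomialDecay.add hf hg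

theorem Negligible.const_mul {f : ℕ → ℝ} (hf : Negligible f) (c : ℝ) :
    Negligible fun n => c * f n :=
  Asymptotics.SuperpolynomialDecay.const_mul hf c

/-! ### Transforming machines -/

theorem size_bits_le (r : List Bool) : (Data.bits r).size ≤ 4 * r.length + 1 := by
  induction r with
  | nil => rfl
  | cons b r ih =>
    change ((if b then Data.node Data.nil Data.nil else Data.nil).size + (Data.bits r).size + 1) ≤ _
    cases b <;> simp <;> omega

theorem size_fst_add_size_snd_le (x : Data) : x.fst.size + x.snd.size ≤ x.size + 1 := by
  cases x <;> simp; omega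

theorem bits_cons (b : Bool) (r : List Bool) :
    Data.bits (b :: r) = Data.node (if b then Data.node Data.nil Data.nil else Data.nil)
      (Data.bits r) := rfl

theorem bits_replicate_false (k : ℕ) : Data.bits (List.replicate k false) = Data.unary k := by
  induction k with
  | zero => rfl
  | succ k ih =>
    rw [List.replicate_succ, bits_cons, ih]
    rfl

theorem len_bits (r : List Bool) : (Data.bits r).len = r.length := by
  induction r with
  | nil => rfl
  | cons b r ih => simp [bits_cons, ih]

theorem len_iterate_snd (i : ℕ) (x : Data) : (Data.snd^[i] x).len = x.len - i := by
  induction i generalizing x with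
  | zero => simp
  | succ i ih =>
    rw [Function.iterate_succ_apply, ih]
    cases x <;> simp

/-- Transfer of one element from the list in the first component to the list in the second. -/
def moveHead (s : Data) : Data := Data.node s.fst.snd (Data.node s.fst.fst s.snd)

theorem iterate_moveHead {i : ℕ} {r : List Bool} (h : i ≤ r.length) (a : List Bool) :
    moveHead^[i] (Data.node (Data.bits r) (Data.bits a)) =
      Data.node (Data.bits (r.drop i)) (Data.bits ((r.take i).reverse ++ a)) := by
  induction i generalizing r a with
  | zero => simp
  | succ i ih =>
    cases r with
    | nil => simp at h
    | cons b r =>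
      rw [Function.iterate_succ_apply]
      refine (ih (by simpa using h) (b :: a)).trans ?_
      simp

theorem size_iterate_moveHead_le (i : ℕ) (s : Data) :
    (moveHead^[i] s).size ≤ s.size + 4 * i + 2 := by
  have step : ∀ s, (moveHead s).size ≤ s.size + 4 := by
    rintro (_ | ⟨_ | ⟨a, b⟩, t⟩) <;> simp [moveHead] <;> omega
  induction i with
  | zero => simp
  | succ i ih =>
    rw [Function.iterate_succ_apply']
    have := step (moveHead^[i] s)
    omega

theorem PolyTime.moveHead {C S : Data → Data} (hC : PolyTime C) (hS : PolyTime S) :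
    PolyTime fun x => PredEnc.moveHead^[(C x).len] (S x) := by
  obtain ⟨p, hp⟩ := hS.exists_size_le
  obtain ⟨q, hq⟩ := hC.exists_size_le
  have hF : PolyTime PredEnc.moveHead := by
    unfold PredEnc.moveHead
    fun_prop
  refine iterate hF hC hS (p + 4 * q + 2) fun x i hi => ?_
  have h1 := size_iterate_moveHead_le i (S x)
  have h2 := hp x
  have h3 := hq x
  have h4 := Data.len_le_size (C x)
  simp only [Polynomial.eval_add, Polynomial.eval_mul, Polynomial.eval_ofNat]
  omega

/-- The coins of a machine input, split into a reversed initial segment of length `k.eval n` (in the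
second component) and the rest, if the security parameter is `n`. -/
noncomputable def splitCoins (k : Polynomial ℕ) (y : Data) : Data :=
  moveHead^[(Data.unary (k.eval y.fst.fst.len)).len] (Data.node y.snd.snd.snd.fst Data.nil)

theorem PolyTime.splitCoins (k : Polynomial ℕ) : PolyTime (splitCoins k) :=
  PolyTime.moveHead (unary_eval k (unary_len (by fun_prop))) (by fun_prop)

/-- The value `G y` if the number of coins in the machine input `y` is `K.eval n`, where `n` is the
length of the list in the first component of the input, and `nil` otherwise. -/
noncomputable def guardCoins (K : Polynomial ℕ) (G : Data → Data) (y : Data) : Data :=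
  Data.ifNode (Data.snd^[(Data.unary (K.eval y.fst.fst.len)).len] y.snd.snd.snd.fst) Data.nil
    (Data.ifNode (Data.snd^[y.snd.snd.snd.fst.len] (Data.unary (K.eval y.fst.fst.len))) Data.nil
      (G y))

theorem PolyTime.guardCoins (K : Polynomial ℕ) {G : Data → Data} (hG : PolyTime G) :
    PolyTime (guardCoins K G) := by
  have hU : PolyTime fun y => Data.unary (K.eval y.fst.fst.len) :=
    unary_eval K (unary_len (by fun_prop))
  exact (drop hU (by fun_prop)).ifNode (const _) ((drop (by fun_prop) hU).ifNode (const _) hG)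

theorem guardCoins_eq (K : Polynomial ℕ) (G : Data → Data) (x s ans : Data) (r : List Bool) :
    guardCoins K G (Data.list [x, s, ans, Data.bits r]) =
      if r.length = K.eval x.fst.len then G (Data.list [x, s, ans, Data.bits r]) else Data.nil := by
  have key : ∀ a b c : Data, Data.ifNode a b c = if a.len = 0 then c else b := by
    intro a b c
    cases a <;> simp
  rw [guardCoins, key, key, len_iterate_snd, len_iterate_snd]
  simp only [Data.list_cons, Data.fst_node, Data.snd_node, Data.len_unary, len_bits]
  split_ifs <;> first | rfl | omega

theorem splitCoins_eq (k : Polynomial ℕ) (x s ans : Data) {r : List Bool}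
    (h : k.eval x.fst.len ≤ r.length) :
    splitCoins k (Data.list [x, s, ans, Data.bits r]) =
      Data.node (Data.bits (r.drop (k.eval x.fst.len)))
        (Data.bits (r.take (k.eval x.fst.len)).reverse) := by
  rw [splitCoins, Data.len_unary]
  refine (iterate_moveHead h []).trans ?_
  rw [List.append_nil]

/-- Polynomials with natural coefficients are monotone, so that the sum of two determines both. -/
theorem eval_eq_of_eval_add_eq {k l : Polynomial ℕ} {m n : ℕ}
    (h : (k + l).eval m = (k + l).eval n) : k.eval m = k.eval n ∧ l.eval m = l.eval n := by
  simp only [Polynomial.eval_add] at h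
  rcases le_total m n with hmn | hmn
  · have h1 := monotone_eval k hmn
    have h2 := monotone_eval l hmn
    simp only at h1 h2
    omega
  · have h1 := monotone_eval k hmn
    have h2 := monotone_eval l hmn
    simp only at h1 h2
    omega

theorem bind_randomBits_add {α : Type*} (k l : ℕ) (g : List Bool → List Bool → PMF α) :
    (randomBits (k + l)).bind (fun r => g (r.take k).reverse (r.drop k)) =
      (randomBits k).bind fun a => (randomBits l).bind (g a) := by
  have := congrArg (fun P => P.bind fun p => g p.1 p.2) (randomBits_add k l)
  simpa [PMF.bind_map, PMF.bind_bind, Function.comp_def] using this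

namespace Machine

variable (A : Machine)

/-- The transition function of `A` on an initial segment of the coins. -/
noncomputable def extStep (l : Polynomial ℕ) : Data → Data :=
  guardCoins (A.coins + l) fun y =>
    A.step (Data.list [y.fst, y.snd.fst, y.snd.snd.fst, (splitCoins A.coins y).snd])

/-- The final function of `A` on an initial segment of the coins; the other coins are added to the
output. -/
noncomputable def extFinish (l : Polynomial ℕ) : Data → Data :=
  guardCoins (A.coins + l) fun y =>
    let o := A.finish (Data.list [y.fst, y.snd.fst, y.snd.snd.fst, (splitCoins A.coins y).snd])
    Data.node o.fst (Data.node o.snd (splitCoins A.coins y).fst)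

theorem extStep_eq (l : Polynomial ℕ) (x s ans : Data) (r : List Bool) :
    A.extStep l (Data.list [x, s, ans, Data.bits r]) =
      if r.length = (A.coins + l).eval x.fst.len then
        A.step (Data.list [x, s, ans, Data.bits (r.take (A.coins.eval x.fst.len)).reverse])
      else Data.nil := by
  rw [extStep, guardCoins_eq]
  split_ifs with h
  · rw [splitCoins_eq _ _ _ _ (by simp at h; omega)]
    rfl
  · rfl

theorem extFinish_eq (l : Polynomial ℕ) (x s ans : Data) (r : List Bool) :
    A.extFinish l (Data.list [x, s, ans, Data.bits r]) =
      if r.length = (A.coins + l).eval x.fst.len then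
        let o := A.finish
          (Data.list [x, s, ans, Data.bits (r.take (A.coins.eval x.fst.len)).reverse])
        Data.node o.fst (Data.node o.snd (Data.bits (r.drop (A.coins.eval x.fst.len))))
      else Data.nil := by
  rw [extFinish, guardCoins_eq]
  split_ifs with h
  · rw [splitCoins_eq _ _ _ _ (by simp at h; omega)]
    rfl
  · rfl

theorem reach_of_reach_extStep {l : Polynomial ℕ} {n i : ℕ} {x s : Data}
    (hx : (A.coins + l).eval x.fst.len = (A.coins + l).eval n)
    (h : Reach (A.extStep l) ((A.coins + l).eval n) x i s) :
    Reach A.step (A.coins.eval n) x i s := by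
  induction h with
  | zero => exact Reach.zero
  | succ ans r _ hr ih =>
    rw [extStep_eq, if_pos (by rw [hr, hx]), (eval_eq_of_eval_add_eq hx).1]
    refine Reach.succ ans _ ih ?_
    simp at hr
    simp [hr]

/-- The machine that works like `A`, but tosses `l` further coins in each round. The further coins
of the last round are added to the output. The number of coins for `A` is computed from the first
component of the input, which is the security parameter in all experiments. Since a machine must
respect its space bound on every input, the machine does nothing if that component does not match
the total number of coins (`guardCoins`): `A` might otherwise receive too many or too few. -/
noncomputable def withCoins (l : Polynomial ℕ) : Machine where
  step := A.extStep l
  finish := A.extFinish l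
  rounds := A.rounds
  coins := A.coins + l
  space := A.space + 4 * (A.coins + l) + 10
  step_poly := by
    have h1 := A.step_poly
    have h2 := PolyTime.splitCoins A.coins
    refine PolyTime.guardCoins _ ?_
    simp only [Data.list_cons, Data.list_nil]
    fun_prop
  finish_poly := by
    have h1 := A.finish_poly
    have h2 := PolyTime.splitCoins A.coins
    refine PolyTime.guardCoins _ ?_
    simp only [Data.list_cons, Data.list_nil]
    fun_prop
  step_size := by
    intro n x i s hi hs ans r hr
    rw [extStep_eq]
    split_ifs with h
    · have hx := h.symm.trans hr
      have := A.step_size n x i s hi (A.reach_of_reach_extStep hx hs) ans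
        (r.take (A.coins.eval x.fst.len)).reverse (by
          rw [(eval_eq_of_eval_add_eq hx).1]
          simp at hr
          simp [hr])
      simp only [Polynomial.eval_add]
      omega
    · simp
  finish_size := by
    intro n x s hs ans r hr
    rw [extFinish_eq]
    split_ifs with h
    · have hx := h.symm.trans hr
      have h1 := A.finish_size n x s (A.reach_of_reach_extStep hx hs) ans
        (r.take (A.coins.eval x.fst.len)).reverse (by
          rw [(eval_eq_of_eval_add_eq hx).1]
          simp at hr
          simp [hr])
      have h2 := size_bits_le (r.drop (A.coins.eval x.fst.len))
      have h3 := monotone_eval (A.coins + l) (Nat.le_add_right n x.size)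
      have h4 := size_fst_add_size_snd_le (A.finish
        (Data.list [x, s, ans, Data.bits (r.take (A.coins.eval x.fst.len)).reverse]))
      simp only [List.length_drop, Polynomial.eval_add, Polynomial.eval_mul,
        Polynomial.eval_ofNat, Data.size_node] at *
      omega
    · simp

theorem loop_withCoins (l : Polynomial ℕ) {n : ℕ} {x : Data} (hx : x.fst = Data.unary n)
    (O : Data → PMF Data) (i : ℕ) : ∀ s ans L, (A.withCoins l).loop n x O i s ans L =
      (A.loop n x O i s ans L).bind fun z => (randomBits (l.eval n)).map fun r =>
        ⟨z.state, Data.node z.out (Data.bits r), z.log⟩ := by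
  have hn : x.fst.len = n := by rw [hx, Data.len_unary]
  induction i with
  | zero =>
    intro s ans L
    have h1 := bind_randomBits_add (A.coins.eval n) (l.eval n) fun a b => PMF.pure
      (let o := A.finish (Data.list [x, s, ans, Data.bits a])
      (⟨o.fst, Data.node o.snd (Data.bits b), L⟩ : Outcome))
    rw [loop, loop, PMF.bind_map]
    refine Eq.trans ?_ h1
    rw [show (A.withCoins l).coins.eval n = A.coins.eval n + l.eval n from Polynomial.eval_add ..]
    refine bind_congr_support fun r hr => ?_
    rw [mem_support_randomBits] at hr
    change PMF.pure (Outcome.mk (A.extFinish l _).fst (A.extFinish l _).snd L) = _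
    rw [extFinish_eq, if_pos (by simp [hr, hn]), hn]
    rfl
  | succ i ih =>
    intro s ans L
    have h1 := bind_randomBits_add (A.coins.eval n) (l.eval n) fun a _ =>
      let o := A.step (Data.list [x, s, ans, Data.bits a])
      (O o.snd).bind fun ans' => (A.withCoins l).loop n x O i o.fst ans' (o.snd :: L)
    rw [loop, loop, PMF.bind_bind]
    refine Eq.trans ?_ (h1.trans ?_)
    · rw [show (A.withCoins l).coins.eval n = A.coins.eval n + l.eval n from
        Polynomial.eval_add ..]
      refine bind_congr_support fun r hr => ?_
      rw [mem_support_randomBits] at hr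
      change (O (A.extStep l _).snd).bind (fun ans' => (A.withCoins l).loop n x O i
        (A.extStep l _).fst ans' ((A.extStep l _).snd :: L)) = _
      rw [extStep_eq, if_pos (by simp [hr, hn]), hn]
    · simp only [PMF.bind_const, ih, PMF.bind_bind]

theorem run_withCoins (l : Polynomial ℕ) {n : ℕ} {x : Data} (hx : x.fst = Data.unary n)
    (O : Data → PMF Data) : (A.withCoins l).run n x O =
      (A.run n x O).bind fun z => (randomBits (l.eval n)).map fun r =>
        ⟨z.state, Data.node z.out (Data.bits r), z.log⟩ :=
  A.loop_withCoins l hx O _ _ _ _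

end Machine

/-- A translation between the oracle interfaces of two experiments. On the input `x`, the simulated
machine is run on the input `inp x`, its query `q` is replaced by `query [x, q]`, the answer `a` to
it by `answer [x, q, a]`, and from its final state and output `z` the final state and output
`post [x, z]` are computed. -/
structure Translation where
  inp : Data → Data
  query : Data → Data
  answer : Data → Data
  post : Data → Data
  inp_poly : PolyTime inp
  query_poly : PolyTime query
  answer_poly : PolyTime answer
  post_poly : PolyTime post

namespace Machine

variable (A : Machine) (T : Translation)

/-- One round of the simulation of `A`: the state consists of the state of `A` and its last query. -/
def transStep (y : Data) : Data :=
  let o := A.step (Data.list [T.inp y.fst, y.snd.fst.fst,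
    T.answer (Data.list [y.fst, y.snd.fst.snd, y.snd.snd.fst]), y.snd.snd.snd.fst])
  Data.node (Data.node o.fst o.snd) (T.query (Data.list [y.fst, o.snd]))

/-- The end of the simulation of `A`. -/
def transFinish (y : Data) : Data :=
  let o := A.finish (Data.list [T.inp y.fst, y.snd.fst.fst,
    T.answer (Data.list [y.fst, y.snd.fst.snd, y.snd.snd.fst]), y.snd.snd.snd.fst])
  T.post (Data.list [y.fst, Data.node o.fst o.snd])

theorem reach_of_reach_transStep {k i : ℕ} {x s : Data} (h : Reach (A.transStep T) k x i s) :
    Reach A.step k (T.inp x) i s.fst := by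
  induction h with
  | zero => exact Reach.zero
  | succ ans r _ hr ih => exact Reach.succ _ r ih hr

/-- The simulation of a machine with the help of a translation. -/
noncomputable def translate : Machine where
  step := A.transStep T
  finish := A.transFinish T
  rounds := A.rounds
  coins := A.coins
  space :=
    let a := A.space.comp (Polynomial.X + T.inp_poly.exists_size_le.choose)
    a + 4 + T.query_poly.exists_size_le.choose.comp (Polynomial.X + a + 5) +
      T.post_poly.exists_size_le.choose.comp (Polynomial.X + a + 5)
  step_poly := by
    have h1 := A.step_poly
    have h2 := T.inp_poly
    have h3 := T.query_poly
    have h4 := T.answer_poly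
    unfold transStep
    simp only [Data.list_cons, Data.list_nil]
    fun_prop
  finish_poly := by
    have h1 := A.finish_poly
    have h2 := T.inp_poly
    have h3 := T.post_poly
    have h4 := T.answer_poly
    unfold transFinish
    simp only [Data.list_cons, Data.list_nil]
    fun_prop
  step_size := by
    intro n x i s hi hs ans r hr
    have h1 := A.step_size n (T.inp x) i s.fst hi (A.reach_of_reach_transStep T hs)
      (T.answer (Data.list [x, s.snd, ans])) r hr
    simp only [transStep]
    generalize hO : A.step _ = o
    replace h1 : o.size ≤ _ := hO ▸ h1
    set p := T.inp_poly.exists_size_le.choose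
    set q := T.query_poly.exists_size_le.choose
    have h2 : (T.inp x).size ≤ p.eval (n + x.size) :=
      (T.inp_poly.exists_size_le.choose_spec x).trans (monotone_eval p (Nat.le_add_left _ _))
    have h3 := h1.trans (monotone_eval A.space
      (show n + (T.inp x).size ≤ n + x.size + p.eval (n + x.size) by omega))
    have h4 := size_fst_add_size_snd_le o
    have h5 := o.fst.one_le_size
    have h6 := (T.query_poly.exists_size_le.choose_spec (Data.list [x, o.snd])).trans
      (monotone_eval q (show _ ≤ n + x.size +
        A.space.eval (n + x.size + p.eval (n + x.size)) + 5 by simp at *; omega))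
    simp only [Data.list_cons, Data.list_nil, Data.fst_node, Data.size_node, Polynomial.eval_add,
      Polynomial.eval_comp, Polynomial.eval_ofNat, Polynomial.eval_X] at *
    omega
  finish_size := by
    intro n x s hs ans r hr
    have h1 := A.finish_size n (T.inp x) s.fst (A.reach_of_reach_transStep T hs)
      (T.answer (Data.list [x, s.snd, ans])) r hr
    simp only [transFinish]
    generalize hO : A.finish _ = o
    replace h1 : o.size ≤ _ := hO ▸ h1
    set p := T.inp_poly.exists_size_le.choose
    set q := T.post_poly.exists_size_le.choose
    have h2 : (T.inp x).size ≤ p.eval (n + x.size) :=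
      (T.inp_poly.exists_size_le.choose_spec x).trans (monotone_eval p (Nat.le_add_left _ _))
    have h3 := h1.trans (monotone_eval A.space
      (show n + (T.inp x).size ≤ n + x.size + p.eval (n + x.size) by omega))
    have h4 := size_fst_add_size_snd_le o
    have h6 := (T.post_poly.exists_size_le.choose_spec
      (Data.list [x, Data.node o.fst o.snd])).trans
      (monotone_eval q (show _ ≤ n + x.size +
        A.space.eval (n + x.size + p.eval (n + x.size)) + 5 by simp at *; omega))
    simp only [Data.list_cons, Data.list_nil, Data.fst_node, Polynomial.eval_add,
      Polynomial.eval_comp, Polynomial.eval_ofNat, Polynomial.eval_X] at *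
    omega

end Machine

/-- The result of the simulation of a run with the result `z`. -/
def Translation.outcome (T : Translation) (x : Data) (z : Outcome) : Outcome :=
  ⟨(T.post (Data.list [x, Data.node z.state z.out])).fst,
    (T.post (Data.list [x, Data.node z.state z.out])).snd,
    z.log.map fun q => T.query (Data.list [x, q])⟩

namespace Machine

variable (A : Machine) (T : Translation)

theorem loop_translate {n : ℕ} {x : Data} {O O' : Data → PMF Data}
    (hO : ∀ q, (O' (T.query (Data.list [x, q]))).map (fun a => T.answer (Data.list [x, q, a])) =
      O q) (i : ℕ) : ∀ s ans L, (A.translate T).loop n x O' i s ans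
        (L.map fun q => T.query (Data.list [x, q])) =
      (A.loop n (T.inp x) O i s.fst (T.answer (Data.list [x, s.snd, ans])) L).map
        (T.outcome x) := by
  induction i with
  | zero =>
    intro s ans L
    rw [loop, loop, PMF.map_comp]
    rfl
  | succ i ih =>
    intro s ans L
    rw [loop, loop, PMF.map_bind]
    refine bind_congr_support fun r _ => ?_
    rw [PMF.map_bind, ← hO, PMF.bind_map]
    refine bind_congr_support fun a _ => ?_
    exact ih (Data.node _ _) a (_ :: L)

/-- If the oracle `O'` answers the translated queries like the oracle `O`, up to the translation of
the answers, then the simulation with `O'` runs like the original machine with `O`. -/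
theorem run_translate {n : ℕ} {x : Data} {O O' : Data → PMF Data}
    (h0 : T.answer (Data.list [x, Data.nil, Data.nil]) = Data.nil)
    (hO : ∀ q, (O' (T.query (Data.list [x, q]))).map (fun a => T.answer (Data.list [x, q, a])) =
      O q) :
    (A.translate T).run n x O' = (A.run n (T.inp x) O).map (T.outcome x) := by
  have := A.loop_translate T (n := n) hO (A.rounds.eval n) Data.nil Data.nil []
  rw [Data.fst_nil, Data.snd_nil, h0] at this
  exact this

end Machine

/-! ### Groups inside sets of data -/

section
variable {S T : Set Data} {op : Data → Data → Data} {e x y z : Data}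

theorem IsGroupOn.mul_mem (hS : IsGroupOn S op) (hx : x ∈ S) (hy : y ∈ S) : op x y ∈ S :=
  hS.1 x hx y hy

theorem IsGroupOn.assoc (hS : IsGroupOn S op) (hx : x ∈ S) (hy : y ∈ S) (hz : z ∈ S) :
    op (op x y) z = op x (op y z) :=
  hS.2.1 x hx y hy z hz

theorem IsIdentity.unique {e' : Data} (h : IsIdentity S op e) (h' : IsIdentity S op e') : e = e' :=
  (h'.2 e h.1).1.symm.trans (h.2 e' h'.1).2

theorem IsGroupOn.mul_left_cancel (hS : IsGroupOn S op) (hx : x ∈ S) (hy : y ∈ S) (hz : z ∈ S)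
    (h : op x y = op x z) : y = z := by
  obtain ⟨e, he, hinv⟩ := hS.2.2
  obtain ⟨x', hx', -, h'⟩ := hinv x hx
  rw [← (he.2 y hy).1, ← (he.2 z hz).1, ← h', hS.assoc hx' hx hy, hS.assoc hx' hx hz, h]

theorem IsGroupOn.isIdentity_of_mul_eq (hS : IsGroupOn S op) (hx : x ∈ S) (hy : y ∈ S)
    (h : op x y = x) : IsIdentity S op y := by
  obtain ⟨e, he, -⟩ := hS.2.2
  obtain rfl := hS.mul_left_cancel hx hy he.1 (h.trans (he.2 x hx).2.symm)
  exact he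

theorem IsGroupOn.isIdentity_of_subset (hS : IsGroupOn S op) (h : T ⊆ S) (he : IsIdentity T op e) :
    IsIdentity S op e :=
  hS.isIdentity_of_mul_eq (h he.1) (h he.1) (he.2 e he.1).1

/-- Two finite groups under the same operation which have a common element `x` have the same
identity, since multiplication by `x` is a permutation of the intersection. -/
theorem IsGroupOn.exists_common_identity {S T : Finset Data} (hS : IsGroupOn (S : Set Data) op)
    (hT : IsGroupOn (T : Set Data) op) (h : ¬ Disjoint S T) :
    ∃ e, IsIdentity (S : Set Data) op e ∧ IsIdentity (T : Set Data) op e := by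
  classical
  obtain ⟨x, hxS, hxT⟩ := Finset.not_disjoint_iff.1 h
  have hmaps : Set.MapsTo (op x) (S ∩ T : Finset Data) (S ∩ T : Finset Data) := fun y hy => by
    simp only [Finset.coe_inter, Set.mem_inter_iff] at hy ⊢
    exact ⟨hS.mul_mem hxS hy.1, hT.mul_mem hxT hy.2⟩
  have hinj : Set.InjOn (op x) (S ∩ T : Finset Data) := fun y hy z hz hyz => by
    simp only [Finset.coe_inter, Set.mem_inter_iff] at hy hz
    exact hS.mul_left_cancel hxS hy.1 hz.1 hyz
  obtain ⟨y, hy, hxy⟩ := Finset.surjOn_of_injOn_of_card_le _ hmaps hinj le_rfl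
    (show x ∈ ((S ∩ T : Finset Data) : Set Data) by simp [hxS, hxT])
  simp only [Finset.coe_inter, Set.mem_inter_iff] at hy
  exact ⟨y, hS.isIdentity_of_mul_eq hxS hy.1 hxy, hT.isIdentity_of_mul_eq hxT hy.2 hxy⟩

theorem IsGroupOn.inv_mul_cancel_left (hS : IsGroupOn S op) (hx : x ∈ S) (hy : y ∈ S) (hz : z ∈ S)
    (h : IsIdentity S op (op y x)) : op y (op x z) = z := by
  rw [← hS.assoc hy hx hz, (h.2 z hz).1]

theorem IsGroupOn.mul_inv_cancel_left (hS : IsGroupOn S op) (hx : x ∈ S) (hy : y ∈ S) (hz : z ∈ S)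
    (h : IsIdentity S op (op y x)) : op x (op y z) = z :=
  hS.mul_left_cancel hy (hS.mul_mem hx (hS.mul_mem hy hz)) hz
    (hS.inv_mul_cancel_left hx hy (hS.mul_mem hy hz) h)

/-- A left inverse in a group of an element of a subgroup belongs to the subgroup. -/
theorem IsGroupOn.inv_mem_of_subset (hS : IsGroupOn S op) (hT : IsGroupOn T op) (hTS : T ⊆ S)
    (hx : x ∈ T) (hy : y ∈ S) (h : IsIdentity S op (op y x)) : y ∈ T := by
  obtain ⟨e, he, hinv⟩ := hT.2.2
  obtain ⟨x', hx', h1, -⟩ := hinv x hx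
  have := hS.inv_mul_cancel_left (hTS hx) hy (hTS hx') h
  rw [h1, ((hS.isIdentity_of_subset hTS he).2 y hy).2] at this
  rwa [this]

theorem map_mul_unif {S : Finset Data} (hS : IsGroupOn (S : Set Data) op) (hx : x ∈ S) :
    (unif S).map (op x) = unif S := by
  obtain ⟨e, he, hinv⟩ := hS.2.2
  obtain ⟨y, hy, hxy, hyx⟩ := hinv x hx
  refine map_unif_eq_unif ⟨x, hx⟩ (fun b hb => hS.mul_mem hx hb) fun u hu =>
    ⟨op y u, hS.mul_mem hy hu, hS.mul_inv_cancel_left hx hy hu (hyx ▸ he), fun b hb h => ?_⟩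
  rw [← h, hS.inv_mul_cancel_left hx hy hb (hyx ▸ he)]

end

/-! ### Generic shift-type schemes -/

namespace PEScheme

variable {E : PEScheme} (hE : E.IsPE) (H : E.GIFT) {n : ℕ} {pp msk f : Data}

theorem exists_key (E : PEScheme) (n : ℕ) (pp msk f : Data) :
    ∃ sk, sk ∈ (E.keyGen n pp msk f).support :=
  (E.keyGen n pp msk f).support_nonempty

namespace GIFT

include H in
theorem satisfiable (hp : E.Params n pp msk) (hf : f ∈ E.Pred n pp) : E.Satisfiable n pp f := by
  obtain ⟨F, -, h⟩ := H.attr_poly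
  exact ⟨hf, _, h n pp msk hp f hf⟩

include hE H in
theorem mem_restricted_iff (hp : E.Params n pp msk) (hf : f ∈ E.Pred n pp) {sk : Data}
    (hsk : sk ∈ (E.keyGen n pp msk f).support) {c : Data} :
    c ∈ E.Restricted n pp msk f ↔ ∃ m, E.decrypt n pp sk c = some m := by
  classical
  rw [Restricted, Finset.mem_filter]
  constructor
  · rintro ⟨hc, sk', hsk', h⟩
    rw [H.decrypt_eq n pp msk hp f (H.satisfiable hp hf) sk' hsk' sk hsk c hc] at h
    exact Option.ne_none_iff_exists'.1 h
  · rintro ⟨m, hm⟩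
    exact ⟨(hE.decrypt_mem n pp msk hp f hf sk hsk c m hm).1, sk, hsk, by simp [hm]⟩

include H in
theorem decrypt_eq_of_mem (hp : E.Params n pp msk) (hf : f ∈ E.Pred n pp) {sk sk' : Data}
    (hsk : sk ∈ (E.keyGen n pp msk f).support) (hsk' : sk' ∈ (E.keyGen n pp msk f).support)
    {c : Data} (hc : c ∈ E.Restricted n pp msk f) :
    E.decrypt n pp sk c = E.decrypt n pp sk' c := by
  classical
  exact H.decrypt_eq n pp msk hp f (H.satisfiable hp hf) sk hsk sk' hsk' c (Finset.mem_filter.1 hc).1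

theorem restricted_isGroupOn (hp : E.Params n pp msk) (hf : f ∈ E.Pred n pp) :
    IsGroupOn (E.Restricted n pp msk f : Set Data) (H.mul n pp) :=
  (H.restricted_group n pp msk hp f (H.satisfiable hp hf)).1

theorem honest_isGroupOn (hp : E.Params n pp msk) (hf : f ∈ E.Pred n pp) :
    IsGroupOn (E.Honest n pp msk f : Set Data) (H.mul n pp) :=
  H.honest_group n pp msk hp f (H.satisfiable hp hf)

theorem honest_subset (E : PEScheme) (n : ℕ) (pp msk f : Data) :
    E.Honest n pp msk f ⊆ E.Restricted n pp msk f := by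
  classical
  exact Finset.filter_subset _ _

theorem N_subset_honest (hp : E.Params n pp msk) (hf : f ∈ E.Pred n pp) :
    H.N n pp f ⊆ E.Honest n pp msk f :=
  (H.N_group n pp msk hp f hf).1.1

theorem ψ_mem_restricted (hp : E.Params n pp msk) (hf : f ∈ E.Pred n pp) {m : Data}
    (hm : m ∈ E.Msg n pp) : H.ψ n pp f m ∈ E.Restricted n pp msk f :=
  honest_subset _ _ _ _ _ (H.ψ_mem n pp msk hp f hf m hm)

theorem ker_subset (n : ℕ) (pp msk f : Data) :
    H.toGroupHomomorphic.Ker n pp msk f ⊆ E.Restricted n pp msk f := by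
  classical
  exact Finset.filter_subset _ _

theorem nonempty_N (hp : E.Params n pp msk) (hf : f ∈ E.Pred n pp) : (H.N n pp f).Nonempty := by
  obtain ⟨e, he, -⟩ := (H.N_group n pp msk hp f hf).2.1.2.2
  exact ⟨e, he.1⟩

theorem nonempty_ker (hp : E.Params n pp msk) (hf : f ∈ E.Pred n pp) :
    (H.toGroupHomomorphic.Ker n pp msk f).Nonempty :=
  (H.nonempty_N hp hf).mono (H.N_subset_ker n pp msk hp f hf)

include H in
theorem nonempty_msg (hp : E.Params n pp msk) : (E.Msg n pp).Nonempty :=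
  Finset.card_pos.1 (zero_lt_one.trans (H.msg_group n pp msk hp).2)

theorem mem_ker_iff (hp : E.Params n pp msk) (hf : f ∈ E.Pred n pp) {sk : Data}
    (hsk : sk ∈ (E.keyGen n pp msk f).support) {c : Data} :
    c ∈ H.toGroupHomomorphic.Ker n pp msk f ↔ c ∈ E.Restricted n pp msk f ∧
      ∃ m, E.decrypt n pp sk c = some m ∧ IsIdentity (E.Msg n pp) (H.msgMul n pp) m := by
  classical
  rw [GroupHomomorphic.Ker, Finset.mem_filter]
  refine and_congr_right fun hc => ⟨?_, fun h => ⟨sk, hsk, h⟩⟩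
  rintro ⟨sk', hsk', h⟩
  rwa [decrypt_eq_of_mem H hp hf hsk hsk' hc]

include hE in
theorem ker_isGroupOn (hp : E.Params n pp msk) (hf : f ∈ E.Pred n pp) :
    IsGroupOn (H.toGroupHomomorphic.Ker n pp msk f : Set Data) (H.mul n pp) := by
  obtain ⟨sk, hsk⟩ := E.exists_key n pp msk f
  have hG := H.restricted_isGroupOn hp hf
  have hM := (H.msg_group n pp msk hp).1
  have hdec := H.decrypt_mul n pp msk hp f (H.satisfiable hp hf) sk hsk
  have hker : ∀ {c}, c ∈ (H.toGroupHomomorphic.Ker n pp msk f : Set Data) ↔ _ :=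
    fun {c} => H.mem_ker_iff hp hf hsk (c := c)
  obtain ⟨e, he, hinv⟩ := hG.2.2
  have hmem : ∀ {c m}, E.decrypt n pp sk c = some m → m ∈ E.Msg n pp := fun {c m} h =>
    (hE.decrypt_mem n pp msk hp f hf sk hsk c m h).2
  have he' : e ∈ (H.toGroupHomomorphic.Ker n pp msk f : Set Data) := by
    obtain ⟨m, hm⟩ := (mem_restricted_iff hE H hp hf hsk).1 he.1
    have := hdec e he.1 e he.1 m m hm hm
    rw [(he.2 e he.1).1, hm, Option.some_inj] at this
    exact hker.2 ⟨he.1, m, hm, hM.isIdentity_of_mul_eq (hmem hm) (hmem hm) this.symm⟩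
  refine ⟨fun x hx y hy => ?_, fun x hx y hy z hz => hG.assoc (hker.1 hx).1 (hker.1 hy).1
    (hker.1 hz).1, e, ⟨he', fun x hx => he.2 x (hker.1 hx).1⟩, fun x hx => ?_⟩
  · obtain ⟨hx, m, hm, h1⟩ := hker.1 hx
    obtain ⟨hy, m', hm', h1'⟩ := hker.1 hy
    exact hker.2 ⟨hG.mul_mem hx hy, m', by rw [hdec x hx y hy m m' hm hm', (h1.2 m' h1'.1).1], h1'⟩
  · obtain ⟨hx, m, hm, h1⟩ := hker.1 hx
    obtain ⟨y, hy, hxy, hyx⟩ := hinv x hx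
    obtain ⟨m', hm'⟩ := (mem_restricted_iff hE H hp hf hsk).1 hy
    obtain ⟨-, m'', hm'', h1''⟩ := hker.1 he'
    have := hdec x hx y hy m m' hm hm'
    rw [hxy, hm'', (h1.2 m' (hmem hm')).1, Option.some_inj] at this
    exact ⟨y, hker.2 ⟨hy, m', hm', this ▸ h1''⟩, hxy, hyx⟩

theorem decrypt_ψ_mul (hp : E.Params n pp msk) (hf : f ∈ E.Pred n pp) {sk : Data}
    (hsk : sk ∈ (E.keyGen n pp msk f).support) {m ν : Data} (hm : m ∈ E.Msg n pp)
    (hν : ν ∈ H.toGroupHomomorphic.Ker n pp msk f) :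
    E.decrypt n pp sk (H.mul n pp (H.ψ n pp f m) ν) = some m :=
  (H.decrypt_iff n pp msk hp f hf sk hsk _ ((H.restricted_isGroupOn hp hf).mul_mem
    (H.ψ_mem_restricted hp hf hm) (H.ker_subset _ _ _ _ hν)) m).2 ⟨hm, ν, hν, rfl⟩

/-- Factorizations `ψ m * ν` with `ν` in the kernel are unique. -/
theorem ψ_mul_inj (hp : E.Params n pp msk) (hf : f ∈ E.Pred n pp) {m m' ν ν' : Data}
    (hm : m ∈ E.Msg n pp) (hm' : m' ∈ E.Msg n pp)
    (hν : ν ∈ H.toGroupHomomorphic.Ker n pp msk f) (hν' : ν' ∈ H.toGroupHomomorphic.Ker n pp msk f)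
    (h : H.mul n pp (H.ψ n pp f m) ν = H.mul n pp (H.ψ n pp f m') ν') : m = m' ∧ ν = ν' := by
  obtain ⟨sk, hsk⟩ := E.exists_key n pp msk f
  have h1 := H.decrypt_ψ_mul hp hf hsk hm hν
  rw [h, H.decrypt_ψ_mul hp hf hsk hm' hν', Option.some_inj] at h1
  subst h1
  exact ⟨rfl, (H.restricted_isGroupOn hp hf).mul_left_cancel (H.ψ_mem_restricted hp hf hm)
    (H.ker_subset _ _ _ _ hν) (H.ker_subset _ _ _ _ hν') h⟩

theorem ψ_inj (hp : E.Params n pp msk) (hf : f ∈ E.Pred n pp) {m m' : Data}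
    (hm : m ∈ E.Msg n pp) (hm' : m' ∈ E.Msg n pp) (h : H.ψ n pp f m = H.ψ n pp f m') : m = m' := by
  obtain ⟨ν, hν⟩ := H.nonempty_ker hp hf
  exact (H.ψ_mul_inj hp hf hm hm' hν hν (by rw [h])).1

include hE in
theorem exists_eq_ψ_mul (hp : E.Params n pp msk) (hf : f ∈ E.Pred n pp) {c : Data}
    (hc : c ∈ E.Restricted n pp msk f) : ∃ m ∈ E.Msg n pp,
      ∃ ν ∈ H.toGroupHomomorphic.Ker n pp msk f, c = H.mul n pp (H.ψ n pp f m) ν := by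
  obtain ⟨sk, hsk⟩ := E.exists_key n pp msk f
  obtain ⟨m, hm⟩ := (mem_restricted_iff hE H hp hf hsk).1 hc
  exact ⟨m, (H.decrypt_iff n pp msk hp f hf sk hsk c hc m).1 hm⟩

include hE in
theorem unif_restricted (hp : E.Params n pp msk) (hf : f ∈ E.Pred n pp) :
    unif (E.Restricted n pp msk f) = (unif (E.Msg n pp)).bind fun m =>
      (unif (H.toGroupHomomorphic.Ker n pp msk f)).map (H.mul n pp (H.ψ n pp f m)) := by
  refine unif_eq_bind_map (H.nonempty_msg hp) (H.nonempty_ker hp hf)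
    (g := fun m => H.mul n pp (H.ψ n pp f m)) (fun m hm ν hν =>
      (H.restricted_isGroupOn hp hf).mul_mem (H.ψ_mem_restricted hp hf hm)
        (H.ker_subset _ _ _ _ hν)) fun c hc => ?_
  obtain ⟨m, hm, ν, hν, rfl⟩ := exists_eq_ψ_mul hE H hp hf hc
  exact ⟨m, hm, ν, hν, rfl, fun m' hm' ν' hν' h => H.ψ_mul_inj hp hf hm' hm hν' hν h⟩

theorem unif_honest (hp : E.Params n pp msk) (hf : f ∈ E.Pred n pp) :
    unif (E.Honest n pp msk f) = (unif (E.Msg n pp)).bind fun m =>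
      (unif (H.N n pp f)).map (H.mul n pp (H.ψ n pp f m)) := by
  refine unif_eq_bind_map (H.nonempty_msg hp) (H.nonempty_N hp hf)
    (g := fun m => H.mul n pp (H.ψ n pp f m)) (fun m hm ν hν =>
      (H.honest_isGroupOn hp hf).mul_mem (H.ψ_mem n pp msk hp f hf m hm)
        (H.N_subset_honest hp hf hν)) fun c hc => ?_
  obtain ⟨m, ⟨hm, ν, hν, rfl⟩, -⟩ := H.ψ_rep n pp msk hp f hf c hc
  exact ⟨m, hm, ν, hν, rfl, fun m' hm' ν' hν' h => H.ψ_mul_inj hp hf hm' hm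
    (H.N_subset_ker n pp msk hp f hf hν') (H.N_subset_ker n pp msk hp f hf hν) h⟩

/-! ### The relation between predicates and attributes -/

include hE in
theorem mem_honest_of_encrypt (hp : E.Params n pp msk) (hf : f ∈ E.Pred n pp) {a m c : Data}
    (ha : a ∈ E.Attr n pp) (hm : m ∈ E.Msg n pp) (hfa : E.sat n pp f a)
    (hc : c ∈ (E.encrypt n pp a m).support) : c ∈ E.Honest n pp msk f := by
  classical
  obtain ⟨sk, hsk⟩ := E.exists_key n pp msk f
  refine Finset.mem_filter.2 ⟨Finset.mem_filter.2 ⟨hE.encrypt_mem n pp msk hp a ha m hm c hc,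
    sk, hsk, ?_⟩, a, ha, hfa, m, hm, hc⟩
  rw [(hE.correct n pp msk hp f hf sk hsk a ha m hm c hc).1 hfa]
  simp

include hE H in
theorem encrypt_mem_restricted_iff (hp : E.Params n pp msk) (hf : f ∈ E.Pred n pp) {a m c : Data}
    (ha : a ∈ E.Attr n pp) (hm : m ∈ E.Msg n pp)
    (hc : c ∈ (E.encrypt n pp a m).support) :
    c ∈ E.Restricted n pp msk f ↔ E.sat n pp f a := by
  obtain ⟨sk, hsk⟩ := E.exists_key n pp msk f
  have := hE.correct n pp msk hp f hf sk hsk a ha m hm c hc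
  rw [mem_restricted_iff hE H hp hf hsk]
  by_cases h : E.sat n pp f a
  · simp [h, this.1 h]
  · simp [h, this.2 h]

theorem sat_τ_self (hp : E.Params n pp msk) {a : Data} (ha : a ∈ E.Attr n pp) :
    E.sat n pp (H.τ n pp a) a := by
  have hf := H.τ_mem n pp msk hp a ha
  obtain ⟨-, a', ha', h⟩ := H.satisfiable hp hf
  exact (H.τ_spec n pp msk hp a ha a' ha' h _ hf).1 h

include hE in
theorem honest_τ_subset (hp : E.Params n pp msk) (hf : f ∈ E.Pred n pp) {a : Data}
    (ha : a ∈ E.Attr n pp) (hfa : E.sat n pp f a) :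
    E.Honest n pp msk (H.τ n pp a) ⊆ E.Honest n pp msk f := by
  classical
  intro c hc
  obtain ⟨-, b, hb, hab, m, hm, hcm⟩ := Finset.mem_filter.1 hc
  exact mem_honest_of_encrypt hE hp hf hb hm
    ((H.τ_spec n pp msk hp a ha b hb hab f hf).2 hfa) hcm

include hE H in
/-- Attributes that satisfy a common predicate satisfy the same predicates: the identity of the
group of honest ciphertexts is an encryption under each of them, up to equivalence. -/
theorem sat_of_sat (hp : E.Params n pp msk) (hf : f ∈ E.Pred n pp) {a b g : Data}
    (ha : a ∈ E.Attr n pp) (hb : b ∈ E.Attr n pp) (hfa : E.sat n pp f a) (hfb : E.sat n pp f b)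
    (hg : g ∈ E.Pred n pp) (hga : E.sat n pp g a) : E.sat n pp g b := by
  classical
  have hid : ∀ a ∈ E.Attr n pp, E.sat n pp f a → ∃ e, e ∈ E.Honest n pp msk (H.τ n pp a) ∧
      IsIdentity (E.Honest n pp msk f : Set Data) (H.mul n pp) e := by
    intro a ha hfa
    obtain ⟨e, he, -⟩ := (H.honest_isGroupOn hp (H.τ_mem n pp msk hp a ha)).2.2
    exact ⟨e, he.1, (H.honest_isGroupOn hp hf).isIdentity_of_subset
      (Finset.coe_subset.2 (honest_τ_subset hE H hp hf ha hfa)) he⟩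
  obtain ⟨e, hea, he⟩ := hid a ha hfa
  obtain ⟨e', heb, he'⟩ := hid b hb hfb
  obtain rfl := he.unique he'
  obtain ⟨-, a', ha', haa', m, hm, hc⟩ := Finset.mem_filter.1 hea
  obtain ⟨-, b', hb', hbb', m', hm', hc'⟩ := Finset.mem_filter.1 heb
  rw [← H.τ_spec n pp msk hp b hb b' hb' hbb' g hg,
    ← encrypt_mem_restricted_iff hE H hp hg hb' hm' hc',
    encrypt_mem_restricted_iff hE H hp hg ha' hm hc, H.τ_spec n pp msk hp a ha a' ha' haa' g hg]
  exact hga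

include hE H in
theorem honest_mem_restricted_iff (hp : E.Params n pp msk) (hf : f ∈ E.Pred n pp) {a c g : Data}
    (ha : a ∈ E.Attr n pp) (hfa : E.sat n pp f a) (hc : c ∈ E.Honest n pp msk f)
    (hg : g ∈ E.Pred n pp) : c ∈ E.Restricted n pp msk g ↔ E.sat n pp g a := by
  classical
  obtain ⟨-, b, hb, hfb, m, hm, hcm⟩ := Finset.mem_filter.1 hc
  rw [encrypt_mem_restricted_iff hE H hp hg hb hm hcm]
  exact ⟨sat_of_sat hE H hp hf hb ha hfb hfa hg, sat_of_sat hE H hp hf ha hb hfa hfb hg⟩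

include hE H in
/-- A predicate that is not satisfied by an attribute in the support of `f` has a disjoint
restricted ciphertext space: otherwise the two groups would share their identity. -/
theorem disjoint_restricted (hp : E.Params n pp msk) (hf : f ∈ E.Pred n pp) {a g : Data}
    (ha : a ∈ E.Attr n pp) (hfa : E.sat n pp f a) (hg : g ∈ E.Pred n pp)
    (hga : ¬ E.sat n pp g a) :
    Disjoint (E.Restricted n pp msk f) (E.Restricted n pp msk g) := by
  by_contra h
  obtain ⟨e, he, he'⟩ := (H.restricted_isGroupOn hp hf).exists_common_identity
    (H.restricted_isGroupOn hp hg) h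
  obtain ⟨e', h1, -⟩ := (H.honest_isGroupOn hp hf).2.2
  obtain rfl := he.unique ((H.restricted_isGroupOn hp hf).isIdentity_of_subset
    (Finset.coe_subset.2 (honest_subset _ _ _ _ _)) h1)
  exact hga ((honest_mem_restricted_iff hE H hp hf ha hfa h1.1 hg).1 he'.1)

include hE H in
theorem not_sat_of_disjoint (hp : E.Params n pp msk) (hf : f ∈ E.Pred n pp) {a g : Data}
    (ha : a ∈ E.Attr n pp) (hfa : E.sat n pp f a) (hg : g ∈ E.Pred n pp)
    (h : Disjoint (E.Restricted n pp msk f) (E.Restricted n pp msk g)) : ¬ E.sat n pp g a := by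
  intro hga
  obtain ⟨e, he, -⟩ := (H.honest_isGroupOn hp hf).2.2
  exact Finset.disjoint_left.1 h (honest_subset _ _ _ _ _ he.1)
    ((honest_mem_restricted_iff hE H hp hf ha hfa he.1 hg).2 hga)

include hE in
theorem mem_map_ψ_iff (hp : E.Params n pp msk) (hf : f ∈ E.Pred n pp) {m c : Data}
    (hm : m ∈ E.Msg n pp) : (∃ ν ∈ H.N n pp f, H.mul n pp (H.ψ n pp f m) ν = c) ↔
      ∃ b ∈ E.Attr n pp, E.sat n pp f b ∧ c ∈ (E.encrypt n pp b m).support := by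
  classical
  obtain ⟨sk, hsk⟩ := E.exists_key n pp msk f
  constructor
  · rintro ⟨ν, hν, rfl⟩
    have h1 := (H.honest_isGroupOn hp hf).mul_mem (H.ψ_mem n pp msk hp f hf m hm)
      (H.N_subset_honest hp hf hν)
    obtain ⟨-, b, hb, hfb, m', hm', hc⟩ := Finset.mem_filter.1 h1
    have h2 := (hE.correct n pp msk hp f hf sk hsk b hb m' hm' _ hc).1 hfb
    rw [H.decrypt_ψ_mul hp hf hsk hm (H.N_subset_ker n pp msk hp f hf hν), Option.some_inj] at h2
    subst h2
    exact ⟨b, hb, hfb, hc⟩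
  · rintro ⟨b, hb, hfb, hc⟩
    obtain ⟨m', ⟨hm', ν, hν, rfl⟩, -⟩ := H.ψ_rep n pp msk hp f hf c
      (mem_honest_of_encrypt hE hp hf hb hm hfb hc)
    have h2 := (hE.correct n pp msk hp f hf sk hsk b hb m hm _ hc).1 hfb
    rw [H.decrypt_ψ_mul hp hf hsk hm' (H.N_subset_ker n pp msk hp f hf hν), Option.some_inj] at h2
    subst h2
    exact ⟨ν, hν, rfl⟩

theorem map_ψ_unif (hp : E.Params n pp msk) (hf : f ∈ E.Pred n pp) {m : Data}
    (hm : m ∈ E.Msg n pp) [DecidableEq Data] :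
    (unif (H.N n pp f)).map (H.mul n pp (H.ψ n pp f m)) =
      unif ((H.N n pp f).image (H.mul n pp (H.ψ n pp f m))) := by
  refine map_unif_eq_unif (H.nonempty_N hp hf) (fun b hb => Finset.mem_image_of_mem _ hb)
    fun u hu => ?_
  obtain ⟨ν, hν, rfl⟩ := Finset.mem_image.1 hu
  exact ⟨ν, hν, rfl, fun ν' hν' h => (H.ψ_mul_inj hp hf hm hm (H.N_subset_ker n pp msk hp f hf hν')
    (H.N_subset_ker n pp msk hp f hf hν) h).2⟩

include hE in
/-- Encryption under an attribute may use the data of any predicate that the attribute satisfies. -/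
theorem encrypt_eq_of_sat (hp : E.Params n pp msk) (hf : f ∈ E.Pred n pp) {a m : Data}
    (ha : a ∈ E.Attr n pp) (hfa : E.sat n pp f a) (hm : m ∈ E.Msg n pp) :
    E.encrypt n pp a m = (unif (H.N n pp f)).map (H.mul n pp (H.ψ n pp f m)) := by
  classical
  have hτ := H.τ_mem n pp msk hp a ha
  have haτ := H.sat_τ_self hp ha
  rw [H.encrypt_eq n pp msk hp a ha m hm]
  refine (H.map_ψ_unif hp hτ hm).trans (Eq.trans ?_ (H.map_ψ_unif hp hf hm).symm)
  congr 1
  ext c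
  rw [Finset.mem_image, Finset.mem_image, mem_map_ψ_iff hE H hp hf hm,
    mem_map_ψ_iff hE H hp hτ hm]
  refine exists_congr fun b => and_congr_right fun hb => and_congr_left fun _ => ⟨fun h => ?_,
    fun h => ?_⟩
  · exact (H.τ_spec n pp msk hp a ha b hb h f hf).2 hfa
  · exact sat_of_sat hE H hp hf ha hb hfa h hτ haτ

end GIFT

end PEScheme

namespace PEScheme

variable {E : PEScheme} (hE : E.IsPE) (H : E.GIFT) {n : ℕ} {pp msk f : Data}

/-! ### The splitting problem -/

namespace GIFT

/-- Polynomial-time functions that perform the operations of a generic shift-type scheme. -/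
structure Algorithms (H : E.GIFT) where
  decrypt : Data → Data
  τ : Data → Data
  ψ : Data → Data
  ψInv : Data → Data
  mul : Data → Data
  inv : Data → Data
  attr : Data → Data
  decrypt_poly : PolyTime decrypt
  τ_poly : PolyTime τ
  ψ_poly : PolyTime ψ
  ψInv_poly : PolyTime ψInv
  mul_poly : PolyTime mul
  inv_poly : PolyTime inv
  attr_poly : PolyTime attr
  decrypt_eq : ∀ {n pp msk}, E.Params n pp msk → ∀ {f}, f ∈ E.Pred n pp →
    ∀ {sk}, sk ∈ (E.keyGen n pp msk f).support → ∀ c,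
      decrypt (Data.list [Data.unary n, pp, sk, c]) = Data.ofOption (E.decrypt n pp sk c)
  τ_eq : ∀ {n pp msk}, E.Params n pp msk → ∀ {a}, a ∈ E.Attr n pp →
    τ (Data.list [Data.unary n, pp, a]) = H.τ n pp a
  ψ_eq : ∀ {n pp msk}, E.Params n pp msk → ∀ {f}, f ∈ E.Pred n pp → ∀ {m}, m ∈ E.Msg n pp →
    ψ (Data.list [Data.unary n, pp, f, m]) = H.ψ n pp f m
  ψInv_eq : ∀ {n pp msk}, E.Params n pp msk → ∀ {f}, f ∈ E.Pred n pp → ∀ {m}, m ∈ E.Msg n pp →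
    ψInv (Data.list [Data.unary n, pp, f, H.ψ n pp f m]) = m
  mul_eq : ∀ {n pp msk}, E.Params n pp msk → ∀ {f}, f ∈ E.Pred n pp →
    ∀ {c}, c ∈ E.Restricted n pp msk f → ∀ {c'}, c' ∈ E.Restricted n pp msk f →
      mul (Data.list [Data.unary n, pp, c, c']) = H.mul n pp c c'
  inv_mem : ∀ {n pp msk}, E.Params n pp msk → ∀ {f}, f ∈ E.Pred n pp →
    ∀ {c}, c ∈ E.Restricted n pp msk f →
      inv (Data.list [Data.unary n, pp, f, c]) ∈ E.Restricted n pp msk f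
  inv_mul : ∀ {n pp msk}, E.Params n pp msk → ∀ {f}, f ∈ E.Pred n pp →
    ∀ {c}, c ∈ E.Restricted n pp msk f →
      IsIdentity (E.Restricted n pp msk f) (H.mul n pp)
        (H.mul n pp (inv (Data.list [Data.unary n, pp, f, c])) c)
  attr_mem : ∀ {n pp msk}, E.Params n pp msk → ∀ {f}, f ∈ E.Pred n pp →
    attr (Data.list [Data.unary n, pp, f]) ∈ E.Attr n pp
  sat_attr : ∀ {n pp msk}, E.Params n pp msk → ∀ {f}, f ∈ E.Pred n pp →
    E.sat n pp f (attr (Data.list [Data.unary n, pp, f]))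

include hE in
theorem exists_algorithms : Nonempty H.Algorithms := by
  obtain ⟨F₁, p₁, h₁⟩ := hE.decrypt_poly
  obtain ⟨F₂, p₂, h₂⟩ := H.τ_poly
  obtain ⟨F₃, p₃, h₃⟩ := H.ψ_poly
  obtain ⟨F₄, p₄, h₄⟩ := H.ψ_inv_poly
  obtain ⟨F₅, p₅, h₅⟩ := H.mul_poly
  obtain ⟨F₆, p₆, h₆⟩ := H.inv_poly
  obtain ⟨F₇, p₇, h₇⟩ := H.attr_poly
  exact ⟨⟨F₁, F₂, F₃, F₄, F₅, F₆, F₇, p₁, p₂, p₃, p₄, p₅, p₆, p₇,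
    fun hp _ hf _ hsk c => h₁ _ _ _ hp _ hf _ hsk c, fun hp _ ha => h₂ _ _ _ hp _ ha,
    fun hp _ hf _ hm => h₃ _ _ _ hp _ hf _ hm, fun hp _ hf _ hm => h₄ _ _ _ hp _ hf _ hm,
    fun hp _ hf _ hc _ hc' => h₅ _ _ _ hp _ hf _ hc _ hc',
    fun hp _ hf _ hc => (h₆ _ _ _ hp _ hf _ hc).1, fun hp _ hf _ hc => (h₆ _ _ _ hp _ hf _ hc).2,
    fun hp _ hf => (h₇ _ _ _ hp _ hf).1, fun hp _ hf => (h₇ _ _ _ hp _ hf).2⟩⟩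

namespace Algorithms

variable {H} (T : H.Algorithms)

attribute [fun_prop] decrypt_poly τ_poly ψ_poly ψInv_poly mul_poly inv_poly attr_poly

/-- From `[n, pp, f, m, c]`, where `c` is a ciphertext of `m` in the restricted ciphertext space
of `f`, the splitting `(r, ν)` of `c`. -/
def split (y : Data) : Data :=
  let r := T.ψ (Data.list [y.fst, y.snd.fst, y.snd.snd.fst, y.snd.snd.snd.fst])
  Data.node r (T.mul (Data.list [y.fst, y.snd.fst,
    T.inv (Data.list [y.fst, y.snd.fst, y.snd.snd.fst, r]), y.snd.snd.snd.snd.fst]))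

theorem split_poly : PolyTime T.split := by
  unfold split
  simp only [Data.list_cons, Data.list_nil]
  fun_prop

theorem split_eq (hp : E.Params n pp msk) (hf : f ∈ E.Pred n pp) {m ν : Data}
    (hm : m ∈ E.Msg n pp) (hν : ν ∈ H.toGroupHomomorphic.Ker n pp msk f) :
    T.split (Data.list [Data.unary n, pp, f, m, H.mul n pp (H.ψ n pp f m) ν]) =
      Data.node (H.ψ n pp f m) ν := by
  have hG := H.restricted_isGroupOn hp hf
  have hψ := H.ψ_mem_restricted hp hf hm
  have hν' := H.ker_subset _ _ _ _ hν
  have h1 := T.ψ_eq hp hf hm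
  have h2 := T.mul_eq hp hf (T.inv_mem hp hf hψ) (hG.mul_mem hψ hν')
  rw [hG.inv_mul_cancel_left hψ (T.inv_mem hp hf hψ) hν' (T.inv_mul hp hf hψ)] at h2
  simp only [Data.list_cons, Data.list_nil, split, Data.fst_node, Data.snd_node] at *
  rw [h1, h2]

end Algorithms

theorem splits_iff {c r ν : Data} : H.groupGen.Splits n pp msk f c r ν ↔
    (∃ m ∈ E.Msg n pp, H.ψ n pp f m = r) ∧ ν ∈ H.toGroupHomomorphic.Ker n pp msk f ∧
      H.mul n pp r ν = c := by
  classical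
  rw [GroupGen.Splits]
  refine and_congr ?_ Iff.rfl
  exact Finset.mem_image

theorem split_ψ_mul (hp : E.Params n pp msk) (hf : f ∈ E.Pred n pp) {m ν : Data}
    (hm : m ∈ E.Msg n pp) (hν : ν ∈ H.toGroupHomomorphic.Ker n pp msk f) :
    H.groupGen.split n pp msk f (H.mul n pp (H.ψ n pp f m) ν) =
      some (Data.node (H.ψ n pp f m) ν) := by
  have h : H.mul n pp (H.ψ n pp f m) ν ∈ H.groupGen.Grp n pp msk f ∧ ∃ z : Data × Data,
      H.groupGen.Splits n pp msk f (H.mul n pp (H.ψ n pp f m) ν) z.1 z.2 :=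
    ⟨(H.restricted_isGroupOn hp hf).mul_mem (H.ψ_mem_restricted hp hf hm)
      (H.ker_subset _ _ _ _ hν), (H.ψ n pp f m, ν), H.splits_iff.2 ⟨⟨m, hm, rfl⟩, hν, rfl⟩⟩
  rw [GroupGen.split, dif_pos h]
  obtain ⟨⟨m', hm', h1⟩, h2, h3⟩ := H.splits_iff.1 h.2.choose_spec
  rw [← h1] at h3
  obtain ⟨rfl, h4⟩ := H.ψ_mul_inj hp hf hm' hm h2 hν h3
  rw [← h1, h4]

theorem split_of_notMem {c : Data} (hc : c ∉ E.Restricted n pp msk f) :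
    H.groupGen.split n pp msk f c = none :=
  dif_neg fun h => hc h.1

include hE in
theorem isSplittingFamily_groupGen : H.groupGen.IsSplittingFamily where
  gen_ppt := hE.setup_ppt
  key_ppt := hE.keyGen_ppt
  mul_mem := H.mul_mem
  grp_subset n pp msk hp f hf := by
    classical
    exact Finset.filter_subset _ _
  grp_group n pp msk hp f hf := H.restricted_group n pp msk hp f (H.satisfiable hp hf)
  sub_group n pp msk hp f hf := by
    refine ⟨⟨H.ker_subset n pp msk f, fun h => ?_⟩, ker_isGroupOn hE H hp hf,
      (H.N_group n pp msk hp f hf).2.2.trans_le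
        (Finset.card_le_card (H.N_subset_ker n pp msk hp f hf))⟩
    -- if the kernel were everything, every message would be the identity
    obtain ⟨sk, hsk⟩ := E.exists_key n pp msk f
    obtain ⟨m, hm, m', hm', hne⟩ := Finset.one_lt_card.1 (H.msg_group n pp msk hp).2
    have key : ∀ m ∈ E.Msg n pp, IsIdentity (E.Msg n pp) (H.msgMul n pp) m := by
      intro m hm
      obtain ⟨c, hc, hcm⟩ := H.decrypt_surj n pp msk hp f (H.satisfiable hp hf) sk hsk m hm
      obtain ⟨-, m', hm', h1⟩ := (H.mem_ker_iff hp hf hsk).1 (h hc)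
      rw [hcm, Option.some_inj] at hm'
      exact hm' ▸ h1
    exact hne ((key m hm).unique (key m' hm'))
  rep_subset n pp msk hp f hf := by
    classical
    intro r hr
    obtain ⟨m, hm, rfl⟩ := Finset.mem_image.1 hr
    exact H.ψ_mem_restricted hp hf hm
  splits_iff n pp msk hp f hf := by
    constructor
    · intro c r ν h
      obtain ⟨⟨m, hm, rfl⟩, hν, rfl⟩ := H.splits_iff.1 h
      exact (H.restricted_isGroupOn hp hf).mul_mem (H.ψ_mem_restricted hp hf hm)
        (H.ker_subset _ _ _ _ hν)
    · intro c hc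
      obtain ⟨m, hm, ν, hν, rfl⟩ := exists_eq_ψ_mul hE H hp hf hc
      refine ⟨(H.ψ n pp f m, ν), H.splits_iff.2 ⟨⟨m, hm, rfl⟩, hν, rfl⟩, ?_⟩
      rintro ⟨r', ν'⟩ h
      obtain ⟨⟨m', hm', rfl⟩, hν', h'⟩ := H.splits_iff.1 h
      obtain ⟨rfl, rfl⟩ := H.ψ_mul_inj hp hf hm' hm hν' hν h'
      rfl
  rep_card n pp msk hp f hf g hg := by
    classical
    have key : ∀ f ∈ E.Pred n pp, (H.groupGen.Rep n pp msk f).card = (E.Msg n pp).card :=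
      fun f hf => Finset.card_image_of_injOn fun m hm m' hm' h => H.ψ_inj hp hf hm hm' h
    rw [key f hf, key g hg]
  split_poly := by
    obtain ⟨T⟩ := exists_algorithms hE H
    refine ⟨fun y => T.split (Data.list [y.fst, y.snd.fst, y.snd.snd.fst,
      (T.decrypt (Data.list [y.fst, y.snd.fst, y.snd.snd.snd.fst, y.snd.snd.snd.snd.fst])).snd,
      y.snd.snd.snd.snd.fst]), ?_, ?_⟩
    · have := T.split_poly
      simp only [Data.list_cons, Data.list_nil]
      fun_prop
    · intro n pp msk hp f hf sk hsk c r ν h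
      obtain ⟨⟨m, hm, rfl⟩, hν, rfl⟩ := H.splits_iff.1 h
      have h1 := T.decrypt_eq hp hf hsk (H.mul n pp (H.ψ n pp f m) ν)
      rw [H.decrypt_ψ_mul hp hf hsk hm hν] at h1
      have h2 := T.split_eq hp hf hm hν
      simp only [Data.list_cons, Data.list_nil, Data.fst_node, Data.snd_node] at *
      rw [h1]
      exact h2

end GIFT

end PEScheme

/-! ### Experiments and oracles -/

theorem advantage_experiment {α β : Type*} (P : PMF α) (Q : α → PMF β)
    (K : α → β → Bool → PMF Bool) :
    advantage (P.bind fun a => (Q a).bind fun z => coin.bind fun b => (K a z b).bind fun w =>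
      PMF.pure (w == b)) =
      |prob (P.bind fun a => (Q a).bind fun z => K a z true) -
        prob (P.bind fun a => (Q a).bind fun z => K a z false)| / 2 := by
  have := advantage_bind_coin (P.bind fun a => (Q a).map fun z => (a, z)) fun p => K p.1 p.2
  simpa only [PMF.bind_bind, PMF.bind_map, Function.comp_def] using this

theorem oracle_key (key : Data → PMF (Option Data)) (aux : Data → Data → PMF (Option Data))
    (f : Data) : oracle key aux (Data.node Data.nil f) = (key f).map Data.ofOption := rfl

theorem oracle_aux (key : Data → PMF (Option Data)) (aux : Data → Data → PMF (Option Data))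
    (a b f c : Data) : oracle key aux (Data.node (Data.node a b) (Data.node f c)) =
      (aux f c).map Data.ofOption := rfl

@[simp] theorem ofOption_none : Data.ofOption none = Data.nil := rfl
@[simp] theorem ofOption_some (d : Data) : Data.ofOption (some d) = Data.node Data.nil d := rfl

theorem map_eq_pure {α β : Type*} {P : PMF α} {g : α → β} {b : β}
    (h : ∀ a ∈ P.support, g a = b) : P.map g = PMF.pure b :=
  (map_congr_support h).trans (PMF.map_const P b)

namespace GroupGen

variable (G : GroupGen)

/-- The guess of the adversary in the second phase for the challenge `c`. -/
noncomputable def respond (A : Adversary) (n : ℕ) (d k : Data) (z : Outcome) (c : Data) : PMF Bool :=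
  (A.second.run n (Data.list [Data.unary n, d, z.state, c]) (G.oracle2 n d k c)).map
    fun w => w.out.toBool

/-- The guess of the adversary when the challenge has the distribution `X`. -/
noncomputable def game (A : Adversary) (X : ℕ → Data → Data → Data → PMF Data) (n : ℕ) : PMF Bool :=
  (G.gen n).bind fun g => (G.phase1 A n g.1 g.2).bind fun z =>
    (X n g.1 g.2 z.out).bind (G.respond A n g.1 g.2 z)

theorem advantage_eq (A : Adversary) (n : ℕ) : advantage (G.experiment A n) =
    |prob (G.game A (fun n d k i => unif (G.Grp n d k i)) n) -
      prob (G.game A (fun n d k i => unif (G.Sub n d k i)) n)| / 2 := by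
  refine Eq.trans ?_ ((advantage_experiment (G.gen n) (fun g => G.phase1 A n g.1 g.2)
    (fun g z b => (unif (if b then G.Grp n g.1 g.2 z.out else G.Sub n g.1 g.2 z.out)).bind
      (G.respond A n g.1 g.2 z))).trans ?_)
  · simp only [respond, PMF.bind_bind, PMF.bind_map, Function.comp_def]
    rfl
  · rfl

end GroupGen

namespace PEScheme

variable {E : PEScheme} (hE : E.IsPE) (H : E.GIFT) {n : ℕ} {pp msk f : Data}

theorem keyOracle_of_notMem {ok : Data → Prop} (hf : f ∉ E.Pred n pp) :
    E.keyOracle n pp msk ok f = PMF.pure none :=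
  if_neg fun h => hf h.1

theorem keyOracle_of_not {ok : Data → Prop} (hf : ¬ ok f) :
    E.keyOracle n pp msk ok f = PMF.pure none :=
  if_neg fun h => hf h.2

theorem keyOracle_of_mem {ok : Data → Prop} (hf : f ∈ E.Pred n pp) (hok : ok f) :
    E.keyOracle n pp msk ok f = (E.keyGen n pp msk f).map some :=
  if_pos ⟨hf, hok⟩

namespace GIFT

open Classical in
/-- The answer of the splitting oracle. -/
noncomputable def splitOracle (n : ℕ) (pp msk f c : Data) : PMF (Option Data) :=
  PMF.pure (if f ∈ E.Pred n pp then H.groupGen.split n pp msk f c else none)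

theorem oracle1_eq : H.groupGen.oracle1 n pp msk =
    oracle (E.keyOracle n pp msk fun _ => True) (H.splitOracle n pp msk) := by
  have : E.keyOracle n pp msk (fun _ => True) = fun i => open Classical in
      if i ∈ E.Pred n pp then (E.keyGen n pp msk i).map some else PMF.pure none := by
    funext i
    by_cases hi : i ∈ E.Pred n pp
    · rw [keyOracle_of_mem hi trivial, if_pos hi]
    · rw [keyOracle_of_notMem hi, if_neg hi]
  rw [this]
  rfl

theorem oracle2_eq (c : Data) : H.groupGen.oracle2 n pp msk c =
    oracle (E.keyOracle n pp msk fun f => c ∉ E.Restricted n pp msk f) noOracle := by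
  rw [GroupGen.oracle2]
  congr 1
  funext i
  by_cases hi : i ∈ E.Pred n pp ∧ c ∉ E.Restricted n pp msk i
  · rw [keyOracle_of_mem hi.1 hi.2]
    exact if_pos hi
  · rw [keyOracle, if_neg hi]
    exact if_neg hi

theorem splitOracle_of_notMem_pred {c : Data} (hf : f ∉ E.Pred n pp) :
    H.splitOracle n pp msk f c = PMF.pure none := by
  rw [splitOracle, if_neg hf]

theorem splitOracle_of_notMem {c : Data} (hc : c ∉ E.Restricted n pp msk f) :
    H.splitOracle n pp msk f c = PMF.pure none := by
  rw [splitOracle, H.split_of_notMem hc, ite_self]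

theorem splitOracle_ψ_mul (hp : E.Params n pp msk) (hf : f ∈ E.Pred n pp) {m ν : Data}
    (hm : m ∈ E.Msg n pp) (hν : ν ∈ H.toGroupHomomorphic.Ker n pp msk f) :
    H.splitOracle n pp msk f (H.mul n pp (H.ψ n pp f m) ν) =
      PMF.pure (some (Data.node (H.ψ n pp f m) ν)) := by
  rw [splitOracle, if_pos hf, H.split_ψ_mul hp hf hm hν]

theorem decOracle_of_notMem_pred {c : Data} (hf : f ∉ E.Pred n pp) :
    E.decOracle n pp msk f c = PMF.pure none :=
  if_neg hf

include hE H in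
theorem decrypt_of_notMem (hp : E.Params n pp msk) (hf : f ∈ E.Pred n pp) {sk c : Data}
    (hsk : sk ∈ (E.keyGen n pp msk f).support) (hc : c ∉ E.Restricted n pp msk f) :
    E.decrypt n pp sk c = none := by
  rw [mem_restricted_iff hE H hp hf hsk] at hc
  exact Option.eq_none_iff_forall_ne_some.2 fun m hm => hc ⟨m, hm⟩

include hE H in
theorem decOracle_of_notMem (hp : E.Params n pp msk) {c : Data}
    (hc : c ∉ E.Restricted n pp msk f) : E.decOracle n pp msk f c = PMF.pure none := by
  by_cases hf : f ∈ E.Pred n pp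
  · rw [decOracle, if_pos hf]
    exact map_eq_pure fun sk hsk => decrypt_of_notMem hE H hp hf hsk hc
  · exact decOracle_of_notMem_pred hf

theorem decOracle_ψ_mul (hp : E.Params n pp msk) (hf : f ∈ E.Pred n pp) {m ν : Data}
    (hm : m ∈ E.Msg n pp) (hν : ν ∈ H.toGroupHomomorphic.Ker n pp msk f) :
    E.decOracle n pp msk f (H.mul n pp (H.ψ n pp f m) ν) = PMF.pure (some m) := by
  rw [decOracle, if_pos hf]
  exact map_eq_pure fun sk hsk => H.decrypt_ψ_mul hp hf hsk hm hν

/-! ### From the restricted ciphertext spaces to honest ciphertexts -/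

namespace Algorithms

variable {H} (T : H.Algorithms)

attribute [fun_prop] split_poly

/-- The simulation of the first phase of a splitting adversary with keys only: instead of a
splitting, a key is requested, and the splitting is computed with it. -/
def splitByKey : Translation where
  inp x := x
  query y := Data.ifNode y.snd.fst.fst (Data.node Data.nil y.snd.fst.snd.fst) y.snd.fst
  answer y :=
    let x := y.fst
    let q := y.snd.fst
    let a := y.snd.snd.fst
    let m := T.decrypt (Data.list [x.fst, x.snd.fst, a.snd, q.snd.snd])
    Data.ifNode q.fst
      (Data.ifNode q.snd
        (Data.ifNode a
          (Data.ifNode m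
            (Data.node Data.nil (T.split
              (Data.list [x.fst, x.snd.fst, q.snd.fst, m.snd, q.snd.snd])))
            Data.nil)
          Data.nil)
        Data.nil)
      a
  post y := Data.node y.snd.fst y.snd.fst.snd
  inp_poly := by fun_prop
  query_poly := by fun_prop
  answer_poly := by
    simp only [Data.list_cons, Data.list_nil]
    fun_prop
  post_poly := by fun_prop

include hE in
theorem splitByKey_oracle (hp : E.Params n pp msk) (q : Data) :
    (oracle (E.keyOracle n pp msk fun _ => True) noOracle
      (T.splitByKey.query (Data.list [Data.list [Data.unary n, pp], q]))).map
      (fun a => T.splitByKey.answer (Data.list [Data.list [Data.unary n, pp], q, a])) =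
    H.groupGen.oracle1 n pp msk q := by
  rw [oracle1_eq]
  rcases q with _ | ⟨_ | ⟨a, b⟩, _ | ⟨f, c⟩⟩
  · exact PMF.pure_map _ _
  · exact PMF.map_id _
  · exact PMF.map_id _
  · refine (map_eq_pure (b := Data.nil) fun a _ => ?_)
    rfl
  · rw [oracle_aux]
    change ((E.keyOracle n pp msk (fun _ => True) f).map Data.ofOption).map _ = _
    by_cases hf : f ∈ E.Pred n pp
    · rw [keyOracle_of_mem hf trivial, PMF.map_comp, PMF.map_comp]
      by_cases hc : c ∈ E.Restricted n pp msk f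
      · obtain ⟨m, hm, ν, hν, rfl⟩ := exists_eq_ψ_mul hE H hp hf hc
        rw [H.splitOracle_ψ_mul hp hf hm hν, PMF.pure_map]
        refine map_eq_pure fun sk hsk => ?_
        have h1 := T.decrypt_eq hp hf hsk (H.mul n pp (H.ψ n pp f m) ν)
        have h2 := T.split_eq hp hf hm hν
        rw [H.decrypt_ψ_mul hp hf hsk hm hν] at h1
        simp only [Data.list_cons, Data.list_nil, splitByKey, Function.comp_apply,
          ofOption_some, Data.fst_node, Data.snd_node, Data.ifNode_node] at *
        rw [h1, Data.snd_node, h2, Data.ifNode_node]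
      · rw [H.splitOracle_of_notMem hc, PMF.pure_map]
        refine map_eq_pure fun sk hsk => ?_
        have h1 := T.decrypt_eq hp hf hsk c
        rw [decrypt_of_notMem hE H hp hf hsk hc] at h1
        simp only [Data.list_cons, Data.list_nil, splitByKey, Function.comp_apply,
          ofOption_some, Data.fst_node, Data.snd_node, Data.ifNode_node, ofOption_none] at *
        rw [h1, Data.ifNode_nil]
    · rw [keyOracle_of_notMem hf, H.splitOracle_of_notMem_pred hf, PMF.pure_map, PMF.pure_map]
      rfl

/-- The challenge for the splitting adversary that is computed from the input
`[n, pp, [st, f], [sk, c]]` of a distinguisher of ciphertexts: the ciphertext `c` itself, or its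
component in the kernel. -/
def challenge (v : Bool) (x : Data) : Data :=
  let sk := x.snd.snd.snd.fst.fst
  let c := x.snd.snd.snd.fst.snd.fst
  if v then c else (T.split (Data.list [x.fst, x.snd.fst, x.snd.snd.fst.snd,
    (T.decrypt (Data.list [x.fst, x.snd.fst, sk, c])).snd, c])).snd

@[fun_prop]
theorem challenge_poly (v : Bool) : PolyTime (T.challenge v) := by
  unfold challenge
  simp only [Data.list_cons, Data.list_nil]
  cases v
  · simp only [Bool.false_eq_true, if_false]
    fun_prop
  · simp only [if_true]
    fun_prop

/-- The simulation of the second phase of a splitting adversary with unrestricted keys: the keys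
that decrypt the challenge are withheld. -/
def withholdKeys (v : Bool) : Translation where
  inp x := Data.list [x.fst, x.snd.fst, x.snd.snd.fst.fst, T.challenge v x]
  query y := y.snd.fst
  answer y :=
    let x := y.fst
    let q := y.snd.fst
    let a := y.snd.snd.fst
    Data.ifNode q.fst a (Data.ifNode a
      (Data.ifNode (T.decrypt (Data.list [x.fst, x.snd.fst, a.snd, T.challenge v x])) Data.nil a)
      Data.nil)
  post y := y.snd.fst
  inp_poly := by
    simp only [Data.list_cons, Data.list_nil]
    fun_prop
  query_poly := by fun_prop
  answer_poly := by
    simp only [Data.list_cons, Data.list_nil]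
    fun_prop
  post_poly := by fun_prop

include hE in
theorem withholdKeys_oracle (hp : E.Params n pp msk) (v : Bool) (y q : Data) :
    (oracle (E.keyOracle n pp msk fun _ => True) noOracle
      ((T.withholdKeys v).query (Data.list [Data.node (Data.unary n) (Data.node pp y), q]))).map
      (fun a => (T.withholdKeys v).answer
        (Data.list [Data.node (Data.unary n) (Data.node pp y), q, a])) =
    H.groupGen.oracle2 n pp msk (T.challenge v (Data.node (Data.unary n) (Data.node pp y))) q := by
  rw [oracle2_eq]
  set c := T.challenge v (Data.node (Data.unary n) (Data.node pp y)) with hc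
  rcases q with _ | ⟨_ | ⟨a, b⟩, q⟩
  · exact PMF.pure_map _ _
  · rw [oracle_key]
    change ((E.keyOracle n pp msk (fun _ => True) q).map Data.ofOption).map _ = _
    by_cases hf : q ∈ E.Pred n pp
    · rw [keyOracle_of_mem hf trivial, PMF.map_comp, PMF.map_comp]
      have key : ∀ sk ∈ (E.keyGen n pp msk q).support, (T.withholdKeys v).answer
          (Data.list [Data.node (Data.unary n) (Data.node pp y), Data.node Data.nil q,
            Data.ofOption (some sk)]) = Data.ifNode (Data.ofOption (E.decrypt n pp sk c)) Data.nil
              (Data.ofOption (some sk)) := by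
        intro sk hsk
        rw [← T.decrypt_eq hp hf hsk c]
        rfl
      by_cases hcq : c ∈ E.Restricted n pp msk q
      · rw [keyOracle_of_not (not_not.2 hcq), PMF.pure_map]
        refine map_eq_pure fun sk hsk => (key sk hsk).trans ?_
        obtain ⟨m, hm⟩ := (mem_restricted_iff hE H hp hf hsk).1 hcq
        rw [hm]
        rfl
      · rw [keyOracle_of_mem hf hcq, PMF.map_comp]
        refine map_congr_support fun sk hsk => (key sk hsk).trans ?_
        rw [decrypt_of_notMem hE H hp hf hsk hcq]
        rfl
    · rw [keyOracle_of_notMem hf, keyOracle_of_notMem hf, PMF.pure_map, PMF.pure_map]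
      rfl
  · rcases q with _ | ⟨f, c⟩
    · exact PMF.pure_map _ _
    · exact PMF.map_id _

theorem splitByKey_outcome (x : Data) (z : Outcome) :
    (T.splitByKey.outcome x z).state = Data.node z.state z.out ∧
      (T.splitByKey.outcome x z).out = z.out := ⟨rfl, rfl⟩

/-- The distinguisher of ciphertexts that simulates a splitting adversary. -/
noncomputable def distinguisher (A : Adversary) (v : Bool) : Adversary where
  first := A.first.translate T.splitByKey
  second := A.second.translate (T.withholdKeys v)

include hE in
theorem ctPhase1_distinguisher (hp : E.Params n pp msk) (A : Adversary) (v : Bool) :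
    E.ctPhase1 (T.distinguisher A v) n pp msk = (H.groupGen.phase1 A n pp msk).map
      (T.splitByKey.outcome (Data.list [Data.unary n, pp])) :=
  Machine.run_translate _ _ rfl (T.splitByKey_oracle hE hp)

include hE in
theorem ctAdmissible_distinguisher {A : Adversary} (hA : H.groupGen.Admissible A) (v : Bool) :
    E.CTAdmissible (T.distinguisher A v) := by
  intro n pp msk hp z hz
  rw [T.ctPhase1_distinguisher hE hp, PMF.mem_support_map_iff] at hz
  obtain ⟨z, hz, rfl⟩ := hz
  exact H.satisfiable hp (hA n pp msk hp z hz).1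

include hE in
theorem second_distinguisher (hp : E.Params n pp msk) (A : Adversary) (v : Bool) (z : Outcome)
    (sk c : Data) :
    ((T.distinguisher A v).second.run n
      (Data.list [Data.unary n, pp, Data.node z.state z.out, Data.list [sk, c]])
      (oracle (E.keyOracle n pp msk fun _ => True) noOracle)).map (fun w => w.out.toBool) =
    H.groupGen.respond A n pp msk z (T.challenge v
      (Data.list [Data.unary n, pp, Data.node z.state z.out,
        Data.list [sk, c]])) := by
  refine (congrArg _ (Machine.run_translate _ _ rfl (T.withholdKeys_oracle hE hp v _))).trans ?_
  rw [PMF.map_comp]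
  rfl

theorem challenge_false_eq (hp : E.Params n pp msk) (hf : f ∈ E.Pred n pp) {sk m ν : Data}
    (hsk : sk ∈ (E.keyGen n pp msk f).support) (hm : m ∈ E.Msg n pp)
    (hν : ν ∈ H.toGroupHomomorphic.Ker n pp msk f) (s : Data) :
    T.challenge false (Data.list [Data.unary n, pp, Data.node s f,
      Data.list [sk, H.mul n pp (H.ψ n pp f m) ν]]) = ν := by
  have h1 := T.decrypt_eq hp hf hsk (H.mul n pp (H.ψ n pp f m) ν)
  have h2 := T.split_eq hp hf hm hν
  rw [H.decrypt_ψ_mul hp hf hsk hm hν] at h1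
  simp only [Data.list_cons, Data.list_nil, challenge, Data.fst_node, Data.snd_node,
    Bool.false_eq_true, if_false, ofOption_some] at *
  rw [h1, Data.snd_node, h2, Data.snd_node]

/-- The distribution of the challenge of the simulated adversary: uniform in the restricted
ciphertext space, in the honest ciphertexts, in the kernel or in `N`. -/
noncomputable def source (H : E.GIFT) (v b : Bool) (n : ℕ) (pp msk f : Data) : PMF Data :=
  match v, b with
  | true, true => unif (E.Restricted n pp msk f)
  | true, false => unif (E.Honest n pp msk f)
  | false, true => unif (H.toGroupHomomorphic.Ker n pp msk f)
  | false, false => unif (H.N n pp f)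

include hE in
theorem map_challenge (hp : E.Params n pp msk) (hf : f ∈ E.Pred n pp) {sk : Data}
    (hsk : sk ∈ (E.keyGen n pp msk f).support) (s : Data) (v b : Bool) :
    (unif (if b then E.Restricted n pp msk f else E.Honest n pp msk f)).map
      (fun c => T.challenge v (Data.list [Data.unary n, pp, Data.node s f, Data.list [sk, c]])) =
    source H v b n pp msk f := by
  cases v
  · cases b
    · simp only [Bool.false_eq_true, if_false]
      rw [H.unif_honest hp hf, PMF.map_bind, source]
      refine Eq.trans ?_ (PMF.bind_const (unif (E.Msg n pp)) _)
      refine bind_congr_support fun m hm => ?_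
      rw [mem_support_unif (H.nonempty_msg hp)] at hm
      rw [PMF.map_comp]
      refine (map_congr_support fun ν hν => ?_).trans (PMF.map_id _)
      rw [mem_support_unif (H.nonempty_N hp hf)] at hν
      exact T.challenge_false_eq hp hf hsk hm (H.N_subset_ker n pp msk hp f hf hν) s
    · simp only [if_true]
      rw [unif_restricted hE H hp hf, PMF.map_bind, source]
      refine Eq.trans ?_ (PMF.bind_const (unif (E.Msg n pp)) _)
      refine bind_congr_support fun m hm => ?_
      rw [mem_support_unif (H.nonempty_msg hp)] at hm
      rw [PMF.map_comp]
      refine (map_congr_support fun ν hν => ?_).trans (PMF.map_id _)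
      rw [mem_support_unif (H.nonempty_ker hp hf)] at hν
      exact T.challenge_false_eq hp hf hsk hm hν s
  · cases b <;> exact PMF.map_id _

include hE in
theorem advantage_distinguisher {A : Adversary} (hA : H.groupGen.Admissible A) (v : Bool) (n : ℕ) :
    advantage (E.ctExperiment (T.distinguisher A v) n) =
      |prob (H.groupGen.game A (source H v true) n) -
        prob (H.groupGen.game A (source H v false) n)| / 2 := by
  have key : ∀ b, ((E.setup n).bind fun g =>
      ((E.ctPhase1 (T.distinguisher A v) n g.1 g.2).bind fun z =>
        (E.keyGen n g.1 g.2 z.out).map fun sk => (z, sk)).bind fun z =>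
      (unif (if b then E.Restricted n g.1 g.2 z.1.out else E.Honest n g.1 g.2 z.1.out)).bind
        fun c => ((T.distinguisher A v).second.run n
          (Data.list [Data.unary n, g.1, z.1.state, Data.list [z.2, c]])
          (oracle (E.keyOracle n g.1 g.2 fun _ => True) noOracle)).map fun w => w.out.toBool) =
      H.groupGen.game A (source H v b) n := by
    intro b
    refine bind_congr_support fun g hg => ?_
    rw [T.ctPhase1_distinguisher hE hg, PMF.bind_map, PMF.bind_bind]
    refine bind_congr_support fun z hz => ?_
    rw [Function.comp_apply, PMF.bind_map]
    simp only [Function.comp_def, splitByKey_outcome]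
    have hf := (hA n g.1 g.2 hg z hz).1
    refine (bind_congr_support fun sk hsk => ?_).trans (PMF.bind_const (E.keyGen n g.1 g.2 z.out) _)
    rw [← T.map_challenge hE hg hf hsk z.state v b, PMF.bind_map]
    refine bind_congr_support fun c _ => ?_
    exact T.second_distinguisher hE hg A v z sk c
  have h := (advantage_experiment (E.setup n) (fun g =>
      (E.ctPhase1 (T.distinguisher A v) n g.1 g.2).bind fun z =>
        (E.keyGen n g.1 g.2 z.out).map fun sk => (z, sk)) fun g z b =>
      (unif (if b then E.Restricted n g.1 g.2 z.1.out else E.Honest n g.1 g.2 z.1.out)).bind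
        fun c => ((T.distinguisher A v).second.run n
          (Data.list [Data.unary n, g.1, z.1.state, Data.list [z.2, c]])
          (oracle (E.keyOracle n g.1 g.2 fun _ => True) noOracle)).map fun w => w.out.toBool)
  beta_reduce at h
  rw [key true, key false] at h
  rw [← h]
  simp only [PMF.bind_bind, PMF.bind_map, Function.comp_def]
  rfl

include hE T in
theorem negligible_source {A : Adversary} (hA : H.groupGen.Admissible A) (v : Bool) :
    Negligible fun n => |prob (H.groupGen.game A (source H v true) n) -
      prob (H.groupGen.game A (source H v false) n)| := by
  have := (H.indist _ (T.ctAdmissible_distinguisher hE hA v)).const_mul 2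
  simpa only [T.advantage_distinguisher hE hA, mul_div_cancel₀ _ (two_ne_zero' ℝ)] using this

/-- In the splitting experiment, the challenges may be replaced by uniform honest ciphertexts and
uniform elements of `N`. -/
theorem negligible_advantage_iff (hE : E.IsPE) (T : H.Algorithms) {A : Adversary}
    (hA : H.groupGen.Admissible A) :
    (Negligible fun n => advantage (H.groupGen.experiment A n)) ↔
      Negligible fun n => |prob (H.groupGen.game A (source H true false) n) -
        prob (H.groupGen.game A (source H false false) n)| := by
  have h1 := negligible_source hE T hA true
  have h2 := negligible_source hE T hA false
  have h3 : ∀ n, advantage (H.groupGen.experiment A n) =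
      |prob (H.groupGen.game A (source H true true) n) -
        prob (H.groupGen.game A (source H false true) n)| / 2 := H.groupGen.advantage_eq A
  constructor
  · intro h
    refine ((h.const_mul 2).add (h1.add h2)).mono fun n => ?_
    rw [h3]
    grind
  · intro h
    refine ((h.add (h1.add h2)).const_mul (1 / 2)).mono fun n => ?_
    rw [h3]
    grind

end Algorithms

end GIFT

end PEScheme

namespace PEScheme

variable {E : PEScheme} (hE : E.IsPE) {H : E.GIFT} {n : ℕ} {pp msk f : Data}

/-! ### The experiment for predicate encryption -/

/-- The guess of the adversary in the second phase for the challenge ciphertext `c`. -/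
noncomputable def ccaRespond (E : PEScheme) (A : Adversary) (n : ℕ) (pp msk : Data) (z : Outcome)
    (c : Data) : PMF Bool :=
  (A.second.run n (Data.list [Data.unary n, pp, z.state, c])
    (oracle (E.keyOracle n pp msk fun f => ¬ E.sat n pp f z.out.fst) noOracle)).map
      fun w => w.out.toBool

/-- The guess of the adversary when the first (`b = false`) or the second (`b = true`) message is
encrypted. -/
noncomputable def ccaGame (E : PEScheme) (A : Adversary) (b : Bool) (n : ℕ) : PMF Bool :=
  (E.setup n).bind fun g => (E.ccaPhase1 A n g.1 g.2).bind fun z =>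
    (E.encrypt n g.1 z.out.fst (if b then z.out.snd.snd.fst else z.out.snd.fst)).bind
      (E.ccaRespond A n g.1 g.2 z)

theorem cca_advantage_eq (A : Adversary) (n : ℕ) : advantage (E.ccaExperiment A n) =
    |prob (E.ccaGame A true n) - prob (E.ccaGame A false n)| / 2 := by
  have h := advantage_experiment (E.setup n) (fun g => E.ccaPhase1 A n g.1 g.2)
    fun g z b => (E.encrypt n g.1 z.out.fst (if b then z.out.snd.snd.fst else z.out.snd.fst)).bind
      (E.ccaRespond A n g.1 g.2 z)
  refine Eq.trans ?_ h
  simp only [ccaRespond, PMF.bind_bind, PMF.bind_map, Function.comp_def]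
  rfl

theorem keyOracle_congr {ok ok' : Data → Prop} (h : ∀ f ∈ E.Pred n pp, (ok f ↔ ok' f)) :
    E.keyOracle n pp msk ok = E.keyOracle n pp msk ok' := by
  funext f
  by_cases hf : f ∈ E.Pred n pp
  · by_cases h' : ok f
    · rw [keyOracle_of_mem hf h', keyOracle_of_mem hf ((h f hf).1 h')]
    · rw [keyOracle_of_not h', keyOracle_of_not fun h'' => h' ((h f hf).2 h'')]
  · rw [keyOracle_of_notMem hf, keyOracle_of_notMem hf]

namespace GIFT

include hE in
/-- For an honest challenge under an attribute `a`, the two experiments withhold the same keys. -/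
theorem oracle2_eq_of_mem_honest (hp : E.Params n pp msk) (hf : f ∈ E.Pred n pp) {a c : Data}
    (ha : a ∈ E.Attr n pp) (hfa : E.sat n pp f a) (hc : c ∈ E.Honest n pp msk f) :
    H.groupGen.oracle2 n pp msk c =
      oracle (E.keyOracle n pp msk fun f => ¬ E.sat n pp f a) noOracle := by
  rw [oracle2_eq, keyOracle_congr fun g hg =>
    not_congr (honest_mem_restricted_iff hE H hp hf ha hfa hc hg)]

namespace Algorithms

variable (T : H.Algorithms)

/-- The simulation of the second phase of an adversary with a modified challenge: the challenge is
multiplied by a ciphertext which is a part of the state. -/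
def shiftChallenge : Translation where
  inp x := Data.list [x.fst, x.snd.fst, x.snd.snd.fst.fst,
    T.mul (Data.list [x.fst, x.snd.fst, x.snd.snd.fst.snd, x.snd.snd.snd.fst])]
  query y := y.snd.fst
  answer y := y.snd.snd.fst
  post y := y.snd.fst
  inp_poly := by
    simp only [Data.list_cons, Data.list_nil]
    fun_prop
  query_poly := by fun_prop
  answer_poly := by fun_prop
  post_poly := by fun_prop

theorem run_shiftChallenge (A : Machine) (s w c : Data) (O : Data → PMF Data) :
    ((A.translate T.shiftChallenge).run n
      (Data.list [Data.unary n, pp, Data.node s w, c]) O).map (fun z => z.out.toBool) =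
    (A.run n (Data.list [Data.unary n, pp, s, T.mul (Data.list [Data.unary n, pp, w, c])]) O).map
      fun z => z.out.toBool := by
  refine (congrArg _ (Machine.run_translate _ _ (O := O) rfl fun q => PMF.map_id _)).trans ?_
  rw [PMF.map_comp]
  rfl

/-! ### Hardness of the splitting problem from security of the scheme -/

/-- The coins for a message, all of which are zero. -/
noncomputable def zeroCoins (l : Polynomial ℕ) (x : Data) : Data := Data.unary (l.eval x.len)

@[fun_prop]
theorem zeroCoins_poly (l : Polynomial ℕ) : PolyTime (zeroCoins l) :=
  PolyTime.unary_eval l (PolyTime.unary_len PolyTime.id)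

/-- The simulation of the first phase of a splitting adversary with a decryption oracle. If the
adversary chooses `f`, an attribute in the support of `f` and two messages `m₀`, `m₁` are chosen,
the first of which is sampled with zero coins. The inverse of `ψ m₀` is added to the state. -/
noncomputable def splitByDecrypt {F : Data → Data} (hF : PolyTime F) (l : Polynomial ℕ) :
    Translation where
  inp x := x
  query y := y.snd.fst
  answer y :=
    let x := y.fst
    let q := y.snd.fst
    let a := y.snd.snd.fst
    Data.ifNode q.fst
      (Data.ifNode a
        (Data.node Data.nil (T.split (Data.list [x.fst, x.snd.fst, q.snd.fst, a.snd, q.snd.snd])))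
        Data.nil)
      a
  post y :=
    let x := y.fst
    let s := y.snd.fst.fst
    let f := y.snd.fst.snd.fst
    let r := y.snd.fst.snd.snd
    let m₀ := F (Data.list [x.fst, x.snd.fst, zeroCoins l x.fst])
    Data.node
      (Data.node s (T.inv (Data.list [x.fst, x.snd.fst, f,
        T.ψ (Data.list [x.fst, x.snd.fst, f, m₀])])))
      (Data.list [T.attr (Data.list [x.fst, x.snd.fst, f]), m₀,
        F (Data.list [x.fst, x.snd.fst, r])])
  inp_poly := by fun_prop
  query_poly := by fun_prop
  answer_poly := by
    simp only [Data.list_cons, Data.list_nil]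
    fun_prop
  post_poly := by
    simp only [Data.list_cons, Data.list_nil]
    fun_prop

variable {F : Data → Data} (hF : PolyTime F) (l : Polynomial ℕ)

include hE in
theorem splitByDecrypt_oracle (hp : E.Params n pp msk) (q : Data) :
    (oracle (E.keyOracle n pp msk fun _ => True) (E.decOracle n pp msk)
      ((T.splitByDecrypt hF l).query (Data.list [Data.list [Data.unary n, pp], q]))).map
      (fun a => (T.splitByDecrypt hF l).answer
        (Data.list [Data.list [Data.unary n, pp], q, a])) =
    H.groupGen.oracle1 n pp msk q := by
  rw [oracle1_eq]
  rcases q with _ | ⟨_ | ⟨a, b⟩, _ | ⟨f, c⟩⟩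
  · exact PMF.pure_map _ _
  · exact PMF.map_id _
  · exact PMF.map_id _
  · exact PMF.pure_map _ _
  · rw [oracle_aux]
    change ((E.decOracle n pp msk f c).map Data.ofOption).map _ = _
    by_cases hf : f ∈ E.Pred n pp
    · by_cases hc : c ∈ E.Restricted n pp msk f
      · obtain ⟨m, hm, ν, hν, rfl⟩ := exists_eq_ψ_mul hE H hp hf hc
        rw [H.splitOracle_ψ_mul hp hf hm hν, H.decOracle_ψ_mul hp hf hm hν, PMF.pure_map,
          PMF.pure_map, PMF.pure_map]
        have h2 := T.split_eq hp hf hm hν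
        simp only [Data.list_cons, Data.list_nil, splitByDecrypt,
          ofOption_some, Data.fst_node, Data.snd_node, Data.ifNode_node] at *
        rw [h2]
      · rw [H.splitOracle_of_notMem hc, decOracle_of_notMem hE H hp hc, PMF.pure_map,
          PMF.pure_map]
        rfl
    · rw [decOracle_of_notMem_pred hf, H.splitOracle_of_notMem_pred hf, PMF.pure_map,
        PMF.pure_map]
      rfl

/-- The adversary against the encryption scheme that simulates a splitting adversary. -/
noncomputable def ccaAdversary (A : Adversary) : Adversary where
  first := (A.first.withCoins l).translate (T.splitByDecrypt hF l)
  second := A.second.translate T.shiftChallenge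

/-- The result of the first phase of the simulation, if the splitting adversary has the result `z`
and the coins `r` are used to choose the second message. -/
noncomputable def ccaOutcome (n : ℕ) (pp : Data) (z : Outcome) (r : List Bool) : Outcome :=
  ⟨Data.node z.state (T.inv (Data.list [Data.unary n, pp, z.out,
    T.ψ (Data.list [Data.unary n, pp, z.out,
      F (Data.list [Data.unary n, pp, Data.unary (l.eval n)])])])),
    Data.list [T.attr (Data.list [Data.unary n, pp, z.out]),
      F (Data.list [Data.unary n, pp, Data.unary (l.eval n)]),
      F (Data.list [Data.unary n, pp, Data.bits r])], z.log⟩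

include hE in
theorem ccaPhase1_ccaAdversary (hp : E.Params n pp msk) (A : Adversary) :
    E.ccaPhase1 (T.ccaAdversary hF l A) n pp msk = (H.groupGen.phase1 A n pp msk).bind fun z =>
      (randomBits (l.eval n)).map (T.ccaOutcome (F := F) l n pp z) := by
  refine (Machine.run_translate _ _ rfl (T.splitByDecrypt_oracle hE hF l hp)).trans ?_
  refine (congrArg _ (A.first.run_withCoins l (n := n) rfl (H.groupGen.oracle1 n pp msk))).trans ?_
  rw [PMF.map_bind]
  refine bind_congr_support fun z _ => ?_
  rw [PMF.map_comp]
  refine congrArg (fun g => PMF.map g _) (funext fun r => ?_)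
  simp only [Function.comp_apply, Translation.outcome, splitByDecrypt, ccaOutcome, Data.list_cons,
    Data.list_nil, Data.fst_node, Data.snd_node, zeroCoins, Data.len_unary, List.map_id']

variable (hmem : ∀ n pp msk, E.Params n pp msk → ∀ r : List Bool, r.length = l.eval n →
  F (Data.list [Data.unary n, pp, Data.bits r]) ∈ E.Msg n pp)

include hmem in
theorem zero_mem_msg (hp : E.Params n pp msk) :
    F (Data.list [Data.unary n, pp, Data.unary (l.eval n)]) ∈ E.Msg n pp := by
  rw [← bits_replicate_false (l.eval n)]
  exact hmem n pp msk hp _ List.length_replicate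

include hE hmem in
theorem ccaAdmissible_ccaAdversary {A : Adversary} (hA : H.groupGen.Admissible A) :
    E.CCAAdmissible (T.ccaAdversary hF l A) := by
  intro n pp msk hp z hz
  rw [T.ccaPhase1_ccaAdversary hE hF l hp, PMF.mem_support_bind_iff] at hz
  obtain ⟨z, hz, hr⟩ := hz
  rw [PMF.mem_support_map_iff] at hr
  obtain ⟨r, hr, rfl⟩ := hr
  rw [mem_support_randomBits] at hr
  obtain ⟨hf, hdisj⟩ := hA n pp msk hp z hz
  exact ⟨_, T.attr_mem hp hf, _, zero_mem_msg l hmem hp, _, hmem n pp msk hp r hr, rfl,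
    fun g hg hgz => not_sat_of_disjoint hE H hp hf (T.attr_mem hp hf) (T.sat_attr hp hf) hg
      (hdisj g hg hgz)⟩

include hE in
/-- The simulated adversary receives the challenge ciphertext divided by `ψ m₀`. -/
theorem ccaRespond_ccaAdversary (hp : E.Params n pp msk) (A : Adversary) (z : Outcome)
    (hf : z.out ∈ E.Pred n pp) (r : List Bool) {w c : Data}
    (hw : w = T.inv (Data.list [Data.unary n, pp, z.out, T.ψ (Data.list [Data.unary n, pp, z.out,
      F (Data.list [Data.unary n, pp, Data.unary (l.eval n)])])]))
    (hwr : w ∈ E.Honest n pp msk z.out) (hc : c ∈ E.Honest n pp msk z.out) :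
    E.ccaRespond (T.ccaAdversary hF l A) n pp msk (T.ccaOutcome (F := F) l n pp z r) c =
      H.groupGen.respond A n pp msk z (H.mul n pp w c) := by
  have hG := H.honest_isGroupOn hp hf
  rw [GroupGen.respond, oracle2_eq_of_mem_honest hE hp hf (T.attr_mem hp hf) (T.sat_attr hp hf)
    (hG.mul_mem hwr hc), ← T.mul_eq hp hf (honest_subset _ _ _ _ _ hwr)
    (honest_subset _ _ _ _ _ hc), hw]
  exact T.run_shiftChallenge _ _ _ _ _

include hmem in
/-- The inverse of `ψ m₀` in the restricted ciphertext space is an honest ciphertext. -/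
theorem inv_ψ_mem_honest (hp : E.Params n pp msk) (hf : f ∈ E.Pred n pp) {w m₀ : Data}
    (hm₀ : m₀ = F (Data.list [Data.unary n, pp, Data.unary (l.eval n)]))
    (hw : w = T.inv (Data.list [Data.unary n, pp, f, T.ψ (Data.list [Data.unary n, pp, f, m₀])])) :
    w ∈ E.Honest n pp msk f ∧ IsIdentity (E.Restricted n pp msk f : Set Data) (H.mul n pp)
      (H.mul n pp w (H.ψ n pp f m₀)) := by
  have h0 : m₀ ∈ E.Msg n pp := hm₀ ▸ zero_mem_msg l hmem hp
  have hψ := H.ψ_mem n pp msk hp f hf m₀ h0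
  have hψ' := H.ψ_mem_restricted hp hf h0
  rw [T.ψ_eq hp hf h0] at hw
  subst hw
  exact ⟨(H.restricted_isGroupOn hp hf).inv_mem_of_subset (H.honest_isGroupOn hp hf)
    (Finset.coe_subset.2 (honest_subset _ _ _ _ _)) hψ (T.inv_mem hp hf hψ')
    (T.inv_mul hp hf hψ'), T.inv_mul hp hf hψ'⟩

include hE hmem in
/-- An encryption of `m₀` becomes a uniform element of `N`. -/
theorem ccaGame_false_ccaAdversary {A : Adversary} (hA : H.groupGen.Admissible A) :
    E.ccaGame (T.ccaAdversary hF l A) false n = H.groupGen.game A (source H false false) n := by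
  refine bind_congr_support fun g hp => ?_
  rw [T.ccaPhase1_ccaAdversary hE hF l hp, PMF.bind_bind]
  refine bind_congr_support fun z hz => ?_
  rw [PMF.bind_map]
  have hf := (hA n g.1 g.2 hp z hz).1
  obtain ⟨hw, hid⟩ := T.inv_ψ_mem_honest l hmem hp hf rfl rfl
  set m₀ := F (Data.list [Data.unary n, g.1, Data.unary (l.eval n)]) with hm₀
  have hm := zero_mem_msg l hmem hp
  rw [← hm₀] at hm
  refine (bind_congr_support fun r _ => ?_).trans (PMF.bind_const (randomBits (l.eval n)) _)
  change (E.encrypt n g.1 (T.attr (Data.list [Data.unary n, g.1, z.out])) m₀).bind _ = _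
  rw [encrypt_eq_of_sat hE H hp hf (T.attr_mem hp hf) (T.sat_attr hp hf) hm, PMF.bind_map]
  refine bind_congr_support fun ν hν => ?_
  rw [mem_support_unif (H.nonempty_N hp hf)] at hν
  have hν := H.N_subset_honest hp hf hν
  have hψ := H.ψ_mem n _ _ hp _ hf _ hm
  rw [Function.comp_apply, T.ccaRespond_ccaAdversary hE hF l hp A z hf r rfl hw
    ((H.honest_isGroupOn hp hf).mul_mem hψ hν),
    (H.restricted_isGroupOn hp hf).inv_mul_cancel_left (honest_subset _ _ _ _ _ hψ)
      (honest_subset _ _ _ _ _ hw) (honest_subset _ _ _ _ _ hν) hid]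

include hE hmem in
/-- An encryption of a random message becomes a uniform honest ciphertext. -/
theorem ccaGame_true_ccaAdversary {A : Adversary} (hA : H.groupGen.Admissible A) {ε : ℕ → ℝ}
    (hε : ∀ n pp msk, E.Params n pp msk → StatClose (ε n)
      ((randomBits (l.eval n)).map fun r => F (Data.list [Data.unary n, pp, Data.bits r]))
      (unif (E.Msg n pp))) :
    |prob (E.ccaGame (T.ccaAdversary hF l A) true n) -
      prob (H.groupGen.game A (source H true false) n)| ≤ ε n := by
  refine abs_prob_bind_sub_le fun g hp => ?_
  rw [T.ccaPhase1_ccaAdversary hE hF l hp, PMF.bind_bind]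
  refine abs_prob_bind_sub_le fun z hz => ?_
  rw [PMF.bind_map]
  have hf := (hA n g.1 g.2 hp z hz).1
  have hG := H.honest_isGroupOn hp hf
  obtain ⟨hw, -⟩ := T.inv_ψ_mem_honest l hmem hp hf rfl rfl
  set w := T.inv (Data.list [Data.unary n, g.1, z.out, T.ψ (Data.list [Data.unary n, g.1, z.out,
    F (Data.list [Data.unary n, g.1, Data.unary (l.eval n)])])]) with hw'
  set a := T.attr (Data.list [Data.unary n, g.1, z.out])
  let K : Data → PMF Bool := fun m => (E.encrypt n g.1 a m).bind fun c =>
    H.groupGen.respond A n g.1 g.2 z (H.mul n g.1 w c)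
  have h1 := abs_prob_bind_sub_le_of_statClose (hε n g.1 g.2 hp) K
  have h2 : (unif (E.Msg n g.1)).bind K =
      (source H true false n g.1 g.2 z.out).bind (H.groupGen.respond A n g.1 g.2 z) := by
    rw [source, ← map_mul_unif hG hw, H.unif_honest hp hf, PMF.bind_map, PMF.bind_bind]
    refine bind_congr_support fun m hm => ?_
    rw [mem_support_unif (H.nonempty_msg hp)] at hm
    rw [← encrypt_eq_of_sat hE H hp hf (T.attr_mem hp hf) (T.sat_attr hp hf) hm]
    rfl
  rw [h2, PMF.bind_map] at h1
  convert h1 using 4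
  refine bind_congr_support fun r hr => bind_congr_support fun c hc => ?_
  rw [mem_support_randomBits] at hr
  exact T.ccaRespond_ccaAdversary hE hF l hp A z hf r hw' hw
    (mem_honest_of_encrypt hE hp hf (T.attr_mem hp hf) (hmem n _ _ hp r hr) (T.sat_attr hp hf) hc)

end Algorithms

theorem isoapHard_of_indCCA (hE : E.IsPE) (H : E.GIFT) (h : E.IND_AD_CCA1) :
    H.groupGen.ISOAPHard := by
  intro A hA
  obtain ⟨T⟩ := exists_algorithms hE H
  obtain ⟨F, hF, l, ε, hε, hs⟩ := H.msg_sample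
  have hmem := fun n pp msk hp => (hs n pp msk hp).1
  rw [Algorithms.negligible_advantage_iff hE T hA]
  have hB := h _ (T.ccaAdmissible_ccaAdversary hE hF l hmem hA)
  refine ((hB.const_mul 2).add hε).mono fun n => ?_
  have h1 := T.ccaGame_true_ccaAdversary hE hF l hmem hA (n := n)
    fun n pp msk hp => (hs n pp msk hp).2
  rw [cca_advantage_eq, T.ccaGame_false_ccaAdversary hE hF l hmem hA]
  grind

end GIFT

end PEScheme

namespace PEScheme

variable {E : PEScheme} (hE : E.IsPE) {H : E.GIFT} {n : ℕ} {pp msk f : Data}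

namespace GIFT

namespace Algorithms

variable (T : H.Algorithms)

/-! ### Security of the scheme from hardness of the splitting problem -/

/-- The simulation of the first phase of an adversary against the encryption scheme with a splitting
oracle. If the adversary chooses the attribute `a` and two messages, the index `τ a` is chosen, and
`ψ m` is added to the state, where `m` is the message selected by `b`. -/
def decryptBySplit (b : Bool) : Translation where
  inp x := x
  query y := y.snd.fst
  answer y :=
    let x := y.fst
    let q := y.snd.fst
    let a := y.snd.snd.fst
    Data.ifNode q.fst
      (Data.ifNode a
        (Data.node Data.nil (T.ψInv (Data.list [x.fst, x.snd.fst, q.snd.fst, a.snd.fst])))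
        Data.nil)
      a
  post y :=
    let x := y.fst
    let s := y.snd.fst.fst
    let o := y.snd.fst.snd
    let f := T.τ (Data.list [x.fst, x.snd.fst, o.fst])
    Data.node
      (Data.node s (T.ψ (Data.list [x.fst, x.snd.fst, f, if b then o.snd.snd.fst else o.snd.fst])))
      f
  inp_poly := by fun_prop
  query_poly := by fun_prop
  answer_poly := by
    simp only [Data.list_cons, Data.list_nil]
    fun_prop
  post_poly := by
    simp only [Data.list_cons, Data.list_nil]
    cases b
    · simp only [Bool.false_eq_true, if_false]
      fun_prop
    · simp only [if_true]
      fun_prop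

include hE in
theorem decryptBySplit_oracle (hp : E.Params n pp msk) (b : Bool) (q : Data) :
    (H.groupGen.oracle1 n pp msk
      ((T.decryptBySplit b).query (Data.list [Data.list [Data.unary n, pp], q]))).map
      (fun a => (T.decryptBySplit b).answer (Data.list [Data.list [Data.unary n, pp], q, a])) =
    oracle (E.keyOracle n pp msk fun _ => True) (E.decOracle n pp msk) q := by
  rw [oracle1_eq]
  rcases q with _ | ⟨_ | ⟨a, b⟩, _ | ⟨f, c⟩⟩
  · exact PMF.pure_map _ _
  · exact PMF.map_id _
  · exact PMF.map_id _
  · exact PMF.pure_map _ _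
  · rw [oracle_aux]
    change ((H.splitOracle n pp msk f c).map Data.ofOption).map _ = _
    by_cases hf : f ∈ E.Pred n pp
    · by_cases hc : c ∈ E.Restricted n pp msk f
      · obtain ⟨m, hm, ν, hν, rfl⟩ := exists_eq_ψ_mul hE H hp hf hc
        rw [H.splitOracle_ψ_mul hp hf hm hν, H.decOracle_ψ_mul hp hf hm hν, PMF.pure_map,
          PMF.pure_map, PMF.pure_map]
        have h2 := T.ψInv_eq hp hf hm
        simp only [Data.list_cons, Data.list_nil, decryptBySplit,
          ofOption_some, Data.fst_node, Data.snd_node, Data.ifNode_node] at *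
        rw [h2]
      · rw [H.splitOracle_of_notMem hc, decOracle_of_notMem hE H hp hc, PMF.pure_map,
          PMF.pure_map]
        rfl
    · rw [decOracle_of_notMem_pred hf, H.splitOracle_of_notMem_pred hf, PMF.pure_map,
        PMF.pure_map]
      rfl

/-- The splitting adversary that simulates an adversary against the encryption scheme, with an
encryption of the message selected by `b`. -/
noncomputable def splittingAdversary (A : Adversary) (b : Bool) : Adversary where
  first := A.first.translate (T.decryptBySplit b)
  second := A.second.translate T.shiftChallenge

/-- The result of the first phase of the simulation, if the simulated adversary has the
result `z`. -/
def splittingOutcome (b : Bool) (n : ℕ) (pp : Data) (z : Outcome) : Outcome :=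
  ⟨Data.node z.state (T.ψ (Data.list [Data.unary n, pp,
      T.τ (Data.list [Data.unary n, pp, z.out.fst]),
      if b then z.out.snd.snd.fst else z.out.snd.fst])),
    T.τ (Data.list [Data.unary n, pp, z.out.fst]), z.log⟩

include hE in
theorem phase1_splittingAdversary (hp : E.Params n pp msk) (A : Adversary) (b : Bool) :
    H.groupGen.phase1 (T.splittingAdversary A b) n pp msk =
      (E.ccaPhase1 A n pp msk).map (T.splittingOutcome b n pp) := by
  refine (Machine.run_translate _ _ rfl (T.decryptBySplit_oracle hE hp b)).trans ?_
  refine congrArg (fun g => PMF.map g _) (funext fun z => ?_)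
  simp only [Translation.outcome, decryptBySplit, splittingOutcome, Data.list_cons,
    Data.list_nil, Data.fst_node, Data.snd_node, List.map_id']

/-- The attribute and the selected message in the output of an admissible adversary. -/
theorem exists_of_ccaAdmissible {A : Adversary} (hA : E.CCAAdmissible A)
    (hp : E.Params n pp msk) {z : Outcome} (hz : z ∈ (E.ccaPhase1 A n pp msk).support) (b : Bool) :
    z.out.fst ∈ E.Attr n pp ∧ (if b then z.out.snd.snd.fst else z.out.snd.fst) ∈ E.Msg n pp ∧
      ∀ f ∈ E.Pred n pp, keyQuery f ∈ z.log → ¬ E.sat n pp f z.out.fst := by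
  obtain ⟨a, ha, m₀, h₀, m₁, h₁, hout, h⟩ := hA n pp msk hp z hz
  rw [hout]
  exact ⟨ha, by cases b <;> assumption, h⟩

include hE in
theorem admissible_splittingAdversary {A : Adversary} (hA : E.CCAAdmissible A) (b : Bool) :
    H.groupGen.Admissible (T.splittingAdversary A b) := by
  intro n pp msk hp z hz
  rw [T.phase1_splittingAdversary hE hp, PMF.mem_support_map_iff] at hz
  obtain ⟨z, hz, rfl⟩ := hz
  obtain ⟨ha, -, h⟩ := exists_of_ccaAdmissible hA hp hz b
  change T.τ (Data.list [Data.unary n, pp, z.out.fst]) ∈ E.Pred n pp ∧ ∀ g ∈ E.Pred n pp,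
    keyQuery g ∈ z.log → Disjoint (E.Restricted n pp msk
      (T.τ (Data.list [Data.unary n, pp, z.out.fst]))) (E.Restricted n pp msk g)
  rw [T.τ_eq hp ha]
  exact ⟨H.τ_mem n pp msk hp _ ha, fun g hg hgz => disjoint_restricted hE H hp
    (H.τ_mem n pp msk hp _ ha) ha (H.sat_τ_self hp ha) hg (h g hg hgz)⟩

include hE in
/-- The simulated adversary receives the challenge multiplied by `ψ m`. -/
theorem respond_splittingAdversary {A : Adversary} (hA : E.CCAAdmissible A)
    (hp : E.Params n pp msk) {z : Outcome} (hz : z ∈ (E.ccaPhase1 A n pp msk).support) (b : Bool)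
    {c : Data} (hc : c ∈ E.Honest n pp msk (H.τ n pp z.out.fst)) :
    H.groupGen.respond (T.splittingAdversary A b) n pp msk (T.splittingOutcome b n pp z) c =
      E.ccaRespond A n pp msk z (H.mul n pp (H.ψ n pp (H.τ n pp z.out.fst)
        (if b then z.out.snd.snd.fst else z.out.snd.fst)) c) := by
  obtain ⟨ha, hm, -⟩ := exists_of_ccaAdmissible hA hp hz b
  have hf := H.τ_mem n pp msk hp _ ha
  rw [GroupGen.respond, oracle2_eq_of_mem_honest hE hp hf ha (H.sat_τ_self hp ha) hc,
    splittingOutcome, T.τ_eq hp ha, T.ψ_eq hp hf hm, ccaRespond,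
    ← T.mul_eq hp hf (H.ψ_mem_restricted hp hf hm) (honest_subset _ _ _ _ _ hc)]
  exact T.run_shiftChallenge _ _ _ _ _

include hE in
theorem game_splittingAdversary {A : Adversary} (hA : E.CCAAdmissible A) (b : Bool)
    {X : ℕ → Data → Data → Data → PMF Data} {Y : Data × Data → Outcome → PMF Data}
    (hX : ∀ n pp msk, E.Params n pp msk → ∀ f ∈ E.Pred n pp,
      ∀ c ∈ (X n pp msk f).support, c ∈ E.Honest n pp msk f)
    (hY : ∀ g ∈ (E.setup n).support, ∀ z ∈ (E.ccaPhase1 A n g.1 g.2).support,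
      (X n g.1 g.2 (H.τ n g.1 z.out.fst)).map (H.mul n g.1 (H.ψ n g.1 (H.τ n g.1 z.out.fst)
        (if b then z.out.snd.snd.fst else z.out.snd.fst))) = Y g z) :
    H.groupGen.game (T.splittingAdversary A b) X n =
      (E.setup n).bind fun g => (E.ccaPhase1 A n g.1 g.2).bind fun z =>
        (Y g z).bind (E.ccaRespond A n g.1 g.2 z) := by
  refine bind_congr_support fun g hp => ?_
  rw [T.phase1_splittingAdversary hE hp, PMF.bind_map]
  refine bind_congr_support fun z hz => ?_
  obtain ⟨ha, hm, -⟩ := exists_of_ccaAdmissible hA hp hz b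
  have hf := H.τ_mem n g.1 g.2 hp _ ha
  rw [← hY g hp z hz, PMF.bind_map]
  change (X n g.1 g.2 (T.τ (Data.list [Data.unary n, g.1, z.out.fst]))).bind _ = _
  rw [T.τ_eq hp ha]
  exact bind_congr_support fun c hc =>
    T.respond_splittingAdversary hE hA hp hz b (hX n _ _ hp _ hf c hc)

include hE in
/-- A uniform element of `N` becomes an encryption of the selected message. -/
theorem game_N_splittingAdversary {A : Adversary} (hA : E.CCAAdmissible A) (b : Bool) :
    H.groupGen.game (T.splittingAdversary A b) (source H false false) n = E.ccaGame A b n := by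
  refine T.game_splittingAdversary hE hA b (fun n pp msk hp f hf c hc => ?_) fun g hp z hz => ?_
  · exact H.N_subset_honest hp hf ((mem_support_unif (H.nonempty_N hp hf)).1 hc)
  · obtain ⟨ha, hm, -⟩ := exists_of_ccaAdmissible hA hp hz b
    exact (H.encrypt_eq n g.1 g.2 hp _ ha _ hm).symm

include hE in
/-- A uniform honest ciphertext remains one, whatever message is selected. -/
theorem game_honest_splittingAdversary {A : Adversary} (hA : E.CCAAdmissible A) (b : Bool) :
    H.groupGen.game (T.splittingAdversary A b) (source H true false) n =
      (E.setup n).bind fun g => (E.ccaPhase1 A n g.1 g.2).bind fun z =>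
        (unif (E.Honest n g.1 g.2 (H.τ n g.1 z.out.fst))).bind (E.ccaRespond A n g.1 g.2 z) := by
  refine T.game_splittingAdversary hE hA b (fun n pp msk hp f hf c hc => ?_) fun g hp z hz => ?_
  · obtain ⟨e, he, -⟩ := (H.honest_isGroupOn hp hf).2.2
    exact (mem_support_unif ⟨e, he.1⟩).1 hc
  · obtain ⟨ha, hm, -⟩ := exists_of_ccaAdmissible hA hp hz b
    have hf := H.τ_mem n g.1 g.2 hp _ ha
    exact map_mul_unif (H.honest_isGroupOn hp hf) (H.ψ_mem n _ _ hp _ hf _ hm)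

end Algorithms

theorem indCCA_of_isoapHard (hE : E.IsPE) (H : E.GIFT) (h : H.groupGen.ISOAPHard) :
    E.IND_AD_CCA1 := by
  intro A hA
  obtain ⟨T⟩ := exists_algorithms hE H
  have key : ∀ b, Negligible fun n =>
      |prob (H.groupGen.game (T.splittingAdversary A true) (Algorithms.source H true false) n) -
        prob (E.ccaGame A b n)| := by
    intro b
    have hB := T.admissible_splittingAdversary hE hA b
    have := (Algorithms.negligible_advantage_iff hE T hB).1 (h _ hB)
    simpa only [T.game_N_splittingAdversary hE hA, T.game_honest_splittingAdversary hE hA] using this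
  refine (((key true).add (key false)).const_mul (1 / 2)).mono fun n => ?_
  rw [cca_advantage_eq]
  grind

end GIFT

end PEScheme

end PredEnc

theorem mainTheorem6 (E : PredEnc.PEScheme) (hE : E.IsPE) (H : E.GIFT) :
    H.groupGen.IsSplittingFamily ∧ (E.IND_AD_CCA1 ↔ H.groupGen.ISOAPHard) :=
  ⟨PredEnc.PEScheme.GIFT.isSplittingFamily_groupGen hE H,
    PredEnc.PEScheme.GIFT.isoapHard_of_indCCA hE H,
    PredEnc.PEScheme.GIFT.indCCA_of_isoapHard hE H⟩
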